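/- Manifolds and metrics are smooth; metrics are pseudo-Riemannian (non-degenerate, of arbitrary signature), and "Einstein" means that $\operatorname{Ric}(g)=c\,g$ for a real constant $c$. $\mathrm{Sc}(g)$ denotes the scalar curvature. **Theorem.** Let $m_1\ge 1$ and $m_2\ge 0$ be integers, and let $(M_1^{m_1},g_1)$ and $(M_2^{m_2},g_2)$ be Einstein manifolds without boundary, of dimensions $m_1,m_2$ and signatures $(p_1,q_1)$, $(p_2,q_2)$, with $$m_2(m_2-1)\,\mathrm{Sc}(g_1)=-m_1(m_1-1)\,\mathrm{Sc}(g_2).$$ Then there is a real number $\mu$ with $$2m_1(m_1-1)\mu=\mathrm{Sc}(g_1)\quad\text{and}\quad 2m_2(m_2-1)\mu=-\mathrm{Sc}(g_2),$$ and for every such $\mu$ the following holds. Put $$I=\begin{cases}[0,\infty)&\text{if }\mu=0,\\ [0,\infty)&\text{if }\mu<0\text{ and }m_2=0,\\ [0,\infty)\setminus\{\sqrt{2/\mu}\}&\text{if }\mu>0\text{ and }m_2=0,\\ [0,\infty)\setminus\{\sqrt{2/|\mu|}\}&\text{otherwise,}\end{cases}$$ let $M^{1,2}=M_1\times M_2\times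 I$, a manifold with boundary $M_1\times M_2\times\{0\}$, and let $r$ be the coordinate on $I$. Then $$g^{1,2}=r^{-2}\bigl(dr^2+(1-\mu r^2/2)^2g_1+(1+\mu r^2/2)^2g_2\bigr)$$ is a metric of signature $(p_1+p_2+1,\,q_1+q_2)$ on the interior $\{r>0\}$ of $M^{1,2}$, it satisfies $$\operatorname{Ric}(g^{1,2})=-(m_1+m_2)\,g^{1,2}$$ there, and it is conformally compact (without requiring $M^{1,2}$ to be compact) with conformal infinity $(M_1\times M_2,[g_1\times g_2])$. That is, there are a smooth non-negative function $\rho$ on $M^{1,2}$ whose zero set is exactly the boundary and whose differential vanishes nowhere on the boundary, and a smooth metric $\bar g$ on all of $M^{1,2}$, non-degenerate up to and including the boundary, with $\bar g=\rho^2g^{1,2}$ on the interior, such that the restriction of $\bar g$ to the boundary, which is identified with $M_1\times M_2$ by the smooth embedding $(x,y)\mapsto(x,y,0)$, is $f\cdot(g_1\times g_2)$ for a smooth positive function $f$ on $M_1\times M_2$. -/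

import Mathlib

open scoped Manifold ContDiff
open Set

noncomputable section

namespace PoincareEinstein

/-! ### Curvature of a (pseudo-)metric given in coordinates

`G : E → E →L[ℝ] E →L[ℝ] ℝ` is a field of bilinear forms on a subset `s` (with unique
differentials) of the finite-dimensional vector space `E`. -/

section Coordinates

variable {E : Type*} [NormedAddCommGroup E] [NormedSpace ℝ E]

/-- Christoffel symbols of the first kind, as a covector:
`2 Γ(u, v)(w) = (∂_u G)(v, w) + (∂_v G)(u, w) - (∂_w G)(u, v)`
(see `christoffelForm_apply`). -/
def christoffelForm (G : E → E →L[ℝ] E →L[ℝ] ℝ) (s : Set E) (y u v : E) : E →L[ℝ] ℝ :=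
  (2⁻¹ : ℝ) • (fderivWithin ℝ G s y u v + fderivWithin ℝ G s y v u
    - ((fderivWithin ℝ G s y).flip u).flip v)

theorem christoffelForm_apply (G : E → E →L[ℝ] E →L[ℝ] ℝ) (s : Set E) (y u v w : E) :
    christoffelForm G s y u v w =
      2⁻¹ * (fderivWithin ℝ G s y u v w + fderivWithin ℝ G s y v u w
        - fderivWithin ℝ G s y w u v) := by
  simp [christoffelForm]

variable [FiniteDimensional ℝ E]

/-- Christoffel symbols of the second kind: `christoffel G s y u v` is the vector `Γ` with
`G y Γ w = christoffelForm G s y u v w` for all `w` (for nondegenerate `G y`); in other words the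
covariant derivative `∇_u v` of the constant vector field `v`. -/
def christoffel (G : E → E →L[ℝ] E →L[ℝ] ℝ) (s : Set E) (y : E) : E →L[ℝ] E →L[ℝ] E :=
  LinearMap.toContinuousBilinearMap (LinearMap.mk₂ ℝ
    (fun u v => (G y).inverse (christoffelForm G s y u v))
    (fun u u' v => by rw [← map_add]; congr 1; ext w; simp [christoffelForm_apply]; ring)
    (fun c u v => by rw [← map_smul]; congr 1; ext w; simp [christoffelForm_apply]; ring)
    (fun u v v' => by rw [← map_add]; congr 1; ext w; simp [christoffelForm_apply]; ring)
    (fun c u v => by rw [← map_smul]; congr 1; ext w; simp [christoffelForm_apply]; ring))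

theorem christoffel_apply (G : E → E →L[ℝ] E →L[ℝ] ℝ) (s : Set E) (y u v : E) :
    christoffel G s y u v = (G y).inverse (christoffelForm G s y u v) := rfl

/-- The Riemann curvature `u ↦ R(u, v) w = ∇_u ∇_v w - ∇_v ∇_u w` (`u`, `v`, `w` constant vector
fields), as an endomorphism in the variable `u`. -/
def riemann (G : E → E →L[ℝ] E →L[ℝ] ℝ) (s : Set E) (y v w : E) : E →ₗ[ℝ] E where
  toFun u := fderivWithin ℝ (christoffel G s) s y u v w
    - fderivWithin ℝ (christoffel G s) s y v u w
    + christoffel G s y u (christoffel G s y v w)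
    - christoffel G s y v (christoffel G s y u w)
  map_add' a b := by simp; abel
  map_smul' c a := by simp [smul_sub, smul_add]

/-- The Ricci curvature `Ric(v, w) = tr (u ↦ R(u, v) w)`. -/
def ricciCoord (G : E → E →L[ℝ] E →L[ℝ] ℝ) (s : Set E) (y : E) : E →ₗ[ℝ] E →ₗ[ℝ] ℝ :=
  LinearMap.mk₂ ℝ (fun v w => LinearMap.trace ℝ E (riemann G s y v w))
    (fun v v' w => by
      rw [← map_add]; congr 1; ext u; simp [riemann]; abel)
    (fun c v w => by
      rw [← map_smul]; congr 1; ext u; simp [riemann, smul_sub, smul_add])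
    (fun v w w' => by
      rw [← map_add]; congr 1; ext u; simp [riemann]; abel)
    (fun c v w => by
      rw [← map_smul]; congr 1; ext u; simp [riemann, smul_sub, smul_add])

/-- The scalar curvature: the trace of the endomorphism `v ↦ (Ric(v, ·))^♯`. -/
def scalarCoord (G : E → E →L[ℝ] E →L[ℝ] ℝ) (s : Set E) (y : E) : ℝ :=
  LinearMap.trace ℝ E ((G y).inverse.toLinearMap ∘ₗ
    (LinearMap.toContinuousLinearMap (𝕜 := ℝ) (E := E) (F' := ℝ)).toLinearMap ∘ₗ
      ricciCoord G s y)

end Coordinates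

/-! ### Pseudo-Riemannian metrics on manifolds (possibly with boundary) -/

section Manifolds

variable {E : Type*} [NormedAddCommGroup E] [NormedSpace ℝ E]
  {H : Type*} [TopologicalSpace H] (I : ModelWithCorners ℝ E H)
  {M : Type*} [TopologicalSpace M] [ChartedSpace H M]

variable (M) in
/-- Fields of bilinear forms on the tangent spaces of `M` (no regularity). -/
abbrev BilinField : Type _ :=
  (x : M) → TangentSpace I x →L[ℝ] TangentSpace I x →L[ℝ] ℝ

/-- `g` is, on the set `U`, a smooth pseudo-Riemannian metric of signature `(p, q)`: each tangent
space is the sum of a `p`-dimensional subspace on which `g` is positive definite and a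
`q`-dimensional subspace on which `g` is negative definite. The values of `g` outside of `U`
are irrelevant. -/
structure IsMetricOn [IsManifold I 1 M] (U : Set M) (p q : ℕ) (g : BilinField I M) : Prop where
  smooth : ContMDiffOn I (I.prod 𝓘(ℝ, E →L[ℝ] E →L[ℝ] ℝ)) ∞
    (fun x => Bundle.TotalSpace.mk' (E →L[ℝ] E →L[ℝ] ℝ)
      (E := fun x : M => TangentSpace I x →L[ℝ] TangentSpace I x →L[ℝ] ℝ) x (g x)) U
  symm : ∀ x ∈ U, ∀ v w : TangentSpace I x, g x v w = g x w v
  nondegenerate : ∀ x ∈ U, ∀ v : TangentSpace I x, (∀ w, g x v w = 0) → v = 0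
  signature : ∀ x ∈ U, ∃ P N : Submodule ℝ (TangentSpace I x), IsCompl P N ∧
    Module.finrank ℝ P = p ∧ Module.finrank ℝ N = q ∧
    (∀ v ∈ P, v ≠ 0 → 0 < g x v v) ∧ (∀ v ∈ N, v ≠ 0 → g x v v < 0)

/-- The pull-back `(f^* g)_x(v, w) = g_{f x}(df_x v, df_x w)`. -/
def pullback {E' : Type*} [NormedAddCommGroup E'] [NormedSpace ℝ E'] {H' : Type*}
    [TopologicalSpace H'] (I' : ModelWithCorners ℝ E' H') {M' : Type*} [TopologicalSpace M']
    [ChartedSpace H' M'] (f : M → M') (g : BilinField I' M') : BilinField I M :=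
  fun x => ContinuousLinearMap.precomp ℝ (mfderiv I I' f x) ∘L g (f x) ∘L mfderiv I I' f x

/-- The square `(df)²` of the differential of a real function `f`. -/
def dSq (f : M → ℝ) : BilinField I M :=
  fun x =>
    let df : TangentSpace I x →L[ℝ] ℝ := mfderiv I 𝓘(ℝ, ℝ) f x
    df.smulRight df

/-- The expression of `g` in the coordinates around `x₀`, i.e. its pull-back under the inverse of
the preferred chart at `x₀`. -/
def inChart (g : BilinField I M) (x₀ : M) : E → E →L[ℝ] E →L[ℝ] ℝ :=
  fun y =>
    let D : E →L[ℝ] TangentSpace I ((extChartAt I x₀).symm y) :=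
      mfderivWithin 𝓘(ℝ, E) I (extChartAt I x₀).symm (range I) y
    ContinuousLinearMap.precomp ℝ D ∘L g ((extChartAt I x₀).symm y) ∘L D

/-- The Ricci tensor of `g` at `x`, computed in the preferred chart at `x`. (The vector space
underlying `TangentSpace I x` is by definition `E`, the identification being the differential at
`x` of that same chart.) -/
def ricci [FiniteDimensional ℝ E] (g : BilinField I M) (x : M) (v w : TangentSpace I x) : ℝ :=
  ricciCoord (E := E) (inChart I g x) (range I) (extChartAt I x x) v w

/-- The scalar curvature of `g` at `x`. -/
def scalarCurvature [FiniteDimensional ℝ E] (g : BilinField I M) (x : M) : ℝ :=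
  scalarCoord (inChart I g x) (range I) (extChartAt I x x)

/-- `Ric(g) = c g` on the set `U`, which is to be open. -/
def IsEinsteinOn [FiniteDimensional ℝ E] (U : Set M) (c : ℝ) (g : BilinField I M) : Prop :=
  ∀ x ∈ U, ∀ v w : TangentSpace I x, ricci I g x v w = c * g x v w

/-- The fields `g` and `h` are conformally related: `h = f g` with a smooth positive function. -/
def ConformallyRelated (g h : BilinField I M) : Prop :=
  ∃ f : M → ℝ, ContMDiff I 𝓘(ℝ, ℝ) ∞ f ∧ (∀ x, 0 < f x) ∧ ∀ x, h x = f x • g x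

/-! ### Conformal compactifications (the manifold with boundary need not be compact) -/

/-- `r` is a smooth non-negative defining function for the boundary of `M`. -/
structure IsDefiningFunction (r : M → ℝ) : Prop where
  smooth : ContMDiff I 𝓘(ℝ, ℝ) ∞ r
  nonneg : ∀ x, 0 ≤ r x
  zero_iff : ∀ x, r x = 0 ↔ x ∈ I.boundary M
  d_ne_zero : ∀ x ∈ I.boundary M, mfderiv I 𝓘(ℝ, ℝ) r x ≠ 0

/-- The metric `g` on the interior of the manifold with boundary `M` has the conformal
compactification `(gbar, r)`: `r` is a defining function for the boundary, and `gbar` is a smooth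
metric on all of `M`, nondegenerate up to and including the boundary, which extends `r² g`. -/
structure IsCompactification [IsManifold I 1 M] (p q : ℕ) (g gbar : BilinField I M)
    (r : M → ℝ) : Prop where
  metric_interior : IsMetricOn I (I.interior M) p q g
  defining : IsDefiningFunction I r
  metric : IsMetricOn I univ p q gbar
  eq_on_interior : ∀ x ∈ I.interior M, gbar x = r x ^ 2 • g x

/-- The metric `g` (of signature `(p, q)`) on the interior of `M` is conformally compact, with
conformal infinity `(B, [h])`, where `B` is identified with the boundary of `M` by means of
`ι : B → M`. -/
def HasConformalInfinity [IsManifold I 1 M] (p q : ℕ) (g : BilinField I M)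
    {E' : Type*} [NormedAddCommGroup E'] [NormedSpace ℝ E'] {H' : Type*}
    [TopologicalSpace H'] (I' : ModelWithCorners ℝ E' H') {B : Type*} [TopologicalSpace B]
    [ChartedSpace H' B] (ι : B → M) (h : BilinField I' B) : Prop :=
  Manifold.IsSmoothEmbedding I' I ∞ ι ∧ range ι = I.boundary M ∧
    ∃ (gbar : BilinField I M) (r : M → ℝ), IsCompactification I p q g gbar r ∧
      ConformallyRelated I' h (pullback I' I ι gbar)

end Manifolds

/-! ### The sub-product construction -/

/-- The subset `I` of `[0, ∞)`. -/
def radialSet (μ : ℝ) (m₂ : ℕ) : Set ℝ :=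
  open scoped Classical in
  if μ = 0 then Ici 0
  else if μ < 0 ∧ m₂ = 0 then Ici 0
  else if 0 < μ ∧ m₂ = 0 then Ici 0 \ {√(2 / μ)}
  else Ici 0 \ {√(2 / |μ|)}

/-- The subset `I` as an open subset of the closed half-line `[0, ∞)`, the latter being the
one-dimensional half-space of Mathlib; in this way `I` is a manifold with boundary `{0}`. -/
def radialDomain (μ : ℝ) (m₂ : ℕ) : TopologicalSpace.Opens (EuclideanHalfSpace 1) where
  carrier := {t | t.1 0 ∈ radialSet μ m₂}
  is_open' := by
    have hc : Continuous fun t : EuclideanHalfSpace 1 => t.1 0 := by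
      have : Continuous fun t : EuclideanHalfSpace 1 => t.1 := continuous_subtype_val
      fun_prop
    have h1 : IsOpen {t : EuclideanHalfSpace 1 | t.1 0 ∈ Ici (0 : ℝ)} := by
      convert isOpen_univ
      ext t
      simpa using t.2
    have h2 (a : ℝ) : IsOpen {t : EuclideanHalfSpace 1 | t.1 0 ∈ Ici (0 : ℝ) \ {a}} :=
      h1.inter (isOpen_compl_singleton.preimage hc)
    unfold radialSet
    split_ifs
    exacts [h1, h1, h2 _, h2 _]

theorem zero_mem_radialDomain (μ : ℝ) (m₂ : ℕ) :
    (0 : EuclideanHalfSpace 1) ∈ radialDomain μ m₂ := by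
  have h0 : (0 : EuclideanHalfSpace 1).1 0 = 0 := rfl
  change (0 : EuclideanHalfSpace 1).1 0 ∈ radialSet μ m₂
  rw [h0]
  unfold radialSet
  split_ifs with h h' h''
  · simp
  · simp
  · simpa using (Real.sqrt_pos.2 (div_pos two_pos h''.1)).ne
  · simpa using (Real.sqrt_pos.2 (div_pos two_pos (abs_pos.2 h))).ne

/-- The two equations for `μ`, where `S₁`, `S₂` are the scalar curvatures (constant functions for
Einstein manifolds): `2 m₁ (m₁ - 1) μ = Sc(g₁)` and `2 m₂ (m₂ - 1) μ = - Sc(g₂)`. -/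
def IsAdmissible {M₁ M₂ : Type*} (m₁ m₂ : ℕ) (S₁ : M₁ → ℝ) (S₂ : M₂ → ℝ) (μ : ℝ) : Prop :=
  (∀ x, 2 * (m₁ : ℝ) * ((m₁ : ℝ) - 1) * μ = S₁ x) ∧
    ∀ y, 2 * (m₂ : ℝ) * ((m₂ : ℝ) - 1) * μ = -S₂ y

section SubProduct

variable (m₁ m₂ : ℕ) (M₁ M₂ : Type*)
  [TopologicalSpace M₁] [ChartedSpace (EuclideanSpace ℝ (Fin m₁)) M₁]
  [TopologicalSpace M₂] [ChartedSpace (EuclideanSpace ℝ (Fin m₂)) M₂]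

/-- The model of `M₁ × M₂ × I`. -/
abbrev subProductModel := (𝓡 m₁).prod ((𝓡 m₂).prod (𝓡∂ 1))

/-- The manifold with boundary `M₁ × M₂ × I`. -/
abbrev SubProduct (μ : ℝ) : Type _ := M₁ × M₂ × radialDomain μ m₂

variable {M₁ M₂}

/-- The coordinate `r` on `M₁ × M₂ × I`. -/
def radius (μ : ℝ) (z : SubProduct m₂ M₁ M₂ μ) : ℝ := z.2.2.1.1 0

/-- The inclusion `(x, y) ↦ (x, y, 0)` of the boundary. -/
def boundaryInclusion (μ : ℝ) (z : M₁ × M₂) : SubProduct m₂ M₁ M₂ μ :=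
  (z.1, z.2, ⟨0, zero_mem_radialDomain μ m₂⟩)

variable (g₁ : BilinField (𝓡 m₁) M₁) (g₂ : BilinField (𝓡 m₂) M₂)

/-- The product `g₁ × g₂` on `M₁ × M₂`. -/
def productMetric : BilinField ((𝓡 m₁).prod (𝓡 m₂)) (M₁ × M₂) :=
  fun z => pullback ((𝓡 m₁).prod (𝓡 m₂)) (𝓡 m₁) Prod.fst g₁ z +
    pullback ((𝓡 m₁).prod (𝓡 m₂)) (𝓡 m₂) Prod.snd g₂ z

/-- The field
`r⁻² (dr² + (1 - μ r² / 2)² g₁ + (1 + μ r² / 2)² g₂)` on `M₁ × M₂ × I`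
(meaningful on the interior `r > 0`). -/
def subProductMetric (μ : ℝ) :
    BilinField (subProductModel m₁ m₂) (SubProduct m₂ M₁ M₂ μ) :=
  fun z => ((radius m₂ μ z) ^ 2)⁻¹ •
    (dSq (subProductModel m₁ m₂) (radius m₂ μ) z
      + (1 - μ * radius m₂ μ z ^ 2 / 2) ^ 2 •
        pullback (subProductModel m₁ m₂) (𝓡 m₁) (fun z => z.1) g₁ z
      + (1 + μ * radius m₂ μ z ^ 2 / 2) ^ 2 •
        pullback (subProductModel m₁ m₂) (𝓡 m₂) (fun z => z.2.1) g₂ z)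

end SubProduct

end PoincareEinstein

end

noncomputable section

namespace PoincareEinstein

open scoped Manifold ContDiff Topology
open Set Filter

/-! ### Curvature in coordinates: locality, regularity, dimension one, Einstein metrics -/

section Coordinates

variable {E : Type*} [NormedAddCommGroup E] [NormedSpace ℝ E]

/-! In the variable s = log r the field becomes ds² + a² g₁ + b² g₂ with a = e^{-s} - (μ/2)e^s and b
= e^{-s} + (μ/2)e^s. Hence a' = -b and b' = -a, so that a'' = a, b'' = b, a'b' = ab and a'² = a² +
2μ, b'² = b² - 2μ. The first two equations give Ric(∂_s, ∂_s) = -(m₁ + m₂). Along the first factor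
the warped product formula gives Ric(g₁) - (a a'' + (m₁ - 1)a'² + m₂ a a'b'/b) g₁. Admissibility of
μ means Ric(g₁) = 2(m₁ - 1)μ g₁, so this is -(m₁ + m₂)a² g₁; the second factor is the same with -μ.

The computation stays in the coordinate r and uses logarithmic derivatives: for C dr² + A g₁ + B g₂
with C' = 2γC, A' = 2αA, B' = 2βB, `ricciCoord_warped` expresses Ricci through α, β, γ and their
derivatives. The facts about a and b turn into a Riccati equation for α (`isLogDerivAt_profile`),
the identity α²Ar² = A + 2μ (`sq_mul_profile`), and αβr² = 1. Curvature is defined in preferred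
charts; the chart of the product is a product chart, and there the field is exactly of warped form
(`inChart_warpedField`).

For the conformal infinity, multiplication by r² gives dr² + (1 - μr²/2)² g₁ + (1 + μr²/2)² g₂,
which is smooth up to r = 0 and restricts there to g₁ × g₂ with conformal factor 1. The points
removed from I are where a coefficient would vanish. If m₂ = 0, a zero of 1 + μr²/2 may remain in I;
it is harmless, since g₂ lives on zero-dimensional spaces and its coefficient can be replaced by a
nowhere vanishing one. -/

theorem christoffelForm_congr {G G' : E → E →L[ℝ] E →L[ℝ] ℝ} {s : Set E} {y : E}
    (hs : s ∈ 𝓝 y) (h : G =ᶠ[𝓝 y] G') (u v : E) :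
    christoffelForm G s y u v = christoffelForm G' univ y u v := by
  simp only [christoffelForm, fderivWithin_univ, fderivWithin_of_mem_nhds hs, h.fderiv_eq]

theorem fderiv_symm {G : E → E →L[ℝ] E →L[ℝ] ℝ} {y : E} (hG : DifferentiableAt ℝ G y)
    (h : ∀ᶠ z in 𝓝 y, ∀ v w, G z v w = G z w v) (u v w : E) :
    fderiv ℝ G y u v w = fderiv ℝ G y u w v := by
  have h1 (v w : E) := (hG.hasFDerivAt.clm_apply (hasFDerivAt_const v y)).clm_apply
    (hasFDerivAt_const w y)
  have h2 := (h1 v w).congr_of_eventuallyEq (f₁ := fun z => G z w v) (h.mono fun z hz => hz w v)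
  have h3 := congrArg (fun L : E →L[ℝ] ℝ => L u) (h2.unique (h1 w v))
  simpa using h3

variable [FiniteDimensional ℝ E]

theorem isInvertible_of_nondegenerate {B : E →L[ℝ] E →L[ℝ] ℝ}
    (h : ∀ v, (∀ w, B v w = 0) → v = 0) : B.IsInvertible := by
  have hinj : Function.Injective B.toLinearMap := by
    rw [injective_iff_map_eq_zero]
    intro v hv
    refine h v fun w => ?_
    have := congrArg (fun L : E →L[ℝ] ℝ => L w) hv
    simpa using this
  have hr : Module.finrank ℝ E = Module.finrank ℝ (E →L[ℝ] ℝ) := by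
    rw [← (LinearMap.toContinuousLinearMap (𝕜 := ℝ) (E := E) (F' := ℝ)).finrank_eq]
    exact (Subspace.dual_finrank_eq).symm
  exact ⟨(LinearEquiv.ofInjectiveOfFinrankEq _ hinj hr).toContinuousLinearEquiv, by ext; rfl⟩

theorem christoffel_congr {G G' : E → E →L[ℝ] E →L[ℝ] ℝ} {s : Set E} {y : E}
    (hs : s ∈ 𝓝 y) (h : G =ᶠ[𝓝 y] G') :
    christoffel G s y = christoffel G' univ y := by
  ext u v
  simp only [christoffel_apply, christoffelForm_congr hs h, h.self_of_nhds]

/-- Ricci depends only on the germ of the metric. At interior points this replaces the range of the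
model with corners by the whole space, so that ordinary derivatives suffice. -/
theorem ricciCoord_congr {G G' : E → E →L[ℝ] E →L[ℝ] ℝ} {s : Set E} {y : E}
    (hs : s ∈ 𝓝 y) (h : G =ᶠ[𝓝 y] G') :
    ricciCoord G s y = ricciCoord G' univ y := by
  have h1 : christoffel G s =ᶠ[𝓝 y] christoffel G' univ := by
    filter_upwards [eventually_mem_nhds_iff.2 hs, h.eventuallyEq_nhds] with z hz hz'
    exact christoffel_congr hz hz'
  ext v w
  change LinearMap.trace ℝ E _ = LinearMap.trace ℝ E _
  congr 1
  ext u
  change fderivWithin ℝ (christoffel G s) s y u v w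
    - fderivWithin ℝ (christoffel G s) s y v u w
    + christoffel G s y u (christoffel G s y v w)
    - christoffel G s y v (christoffel G s y u w) = fderivWithin ℝ (christoffel G' univ) univ y u v w
    - fderivWithin ℝ (christoffel G' univ) univ y v u w
    + christoffel G' univ y u (christoffel G' univ y v w)
    - christoffel G' univ y v (christoffel G' univ y u w)
  simp only [fderivWithin_univ, fderivWithin_of_mem_nhds hs, h1.fderiv_eq, h1.self_of_nhds]

theorem map_christoffel {G : E → E →L[ℝ] E →L[ℝ] ℝ} {y : E}
    (h : ∀ v, (∀ w, G y v w = 0) → v = 0) (s : Set E) (u v : E) :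
    G y (christoffel G s y u v) = christoffelForm G s y u v := by
  obtain ⟨e, he⟩ := isInvertible_of_nondegenerate h
  rw [christoffel_apply, ← he]
  simp

/-- Nondegeneracy makes the lowered equation determine the vector. A proposed formula for the
Christoffel symbols can thus be verified without inverting the metric. -/
theorem christoffel_eq {G : E → E →L[ℝ] E →L[ℝ] ℝ} {y : E} {s : Set E} {u v x : E}
    (h : ∀ v, (∀ w, G y v w = 0) → v = 0)
    (hx : ∀ w, G y x w = christoffelForm G s y u v w) :
    christoffel G s y u v = x := by
  obtain ⟨e, he⟩ := isInvertible_of_nondegenerate h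
  rw [christoffel_apply, show christoffelForm G s y u v = G y x from
    ContinuousLinearMap.ext fun w => (hx w).symm, ← he]
  simp

/-- A finite basis of `E` identifies `E →L[ℝ] F` with a finite power of `F`. -/
theorem differentiableAt_of_apply {D F : Type*} [NormedAddCommGroup D] [NormedSpace ℝ D]
    [NormedAddCommGroup F] [NormedSpace ℝ F] {f : D → E →L[ℝ] F} {y : D}
    (hf : ∀ u, DifferentiableAt ℝ (fun z => f z u) y) : DifferentiableAt ℝ f y := by
  let Φ : (E →L[ℝ] F) ≃L[ℝ] (Fin (Module.finrank ℝ E) → F) :=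
    (((Module.finBasis ℝ E).equivFunL).arrowCongr (ContinuousLinearEquiv.refl ℝ F)).trans
      (ContinuousLinearEquiv.piRing _)
  rw [← Φ.comp_differentiableAt_iff, differentiableAt_pi]
  exact fun i => hf _

/-- `G` is, near `y`, a twice differentiable field of symmetric nondegenerate forms. -/
structure IsRegularAt (G : E → E →L[ℝ] E →L[ℝ] ℝ) (y : E) : Prop where
  contDiffAt : ContDiffAt ℝ 2 G y
  symm : ∀ᶠ z in 𝓝 y, ∀ v w, G z v w = G z w v
  nondegenerate : ∀ᶠ z in 𝓝 y, ∀ v, (∀ w, G z v w = 0) → v = 0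

namespace IsRegularAt

variable {G : E → E →L[ℝ] E →L[ℝ] ℝ} {y : E}

omit [FiniteDimensional ℝ E] in
theorem differentiableAt (h : IsRegularAt G y) : DifferentiableAt ℝ G y :=
  h.contDiffAt.differentiableAt (by norm_num)

omit [FiniteDimensional ℝ E] in
theorem eventually (h : IsRegularAt G y) : ∀ᶠ z in 𝓝 y, IsRegularAt G z := by
  filter_upwards [h.contDiffAt.eventually (by decide), h.symm.eventually_nhds,
    h.nondegenerate.eventually_nhds] with z h1 h2 h3
  exact ⟨h1, h2, h3⟩

theorem christoffel_comm (h : IsRegularAt G y) (u v : E) :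
    christoffel G univ y u v = christoffel G univ y v u := by
  refine christoffel_eq h.nondegenerate.self_of_nhds fun w => ?_
  rw [map_christoffel h.nondegenerate.self_of_nhds, christoffelForm_apply, christoffelForm_apply]
  simp only [fderivWithin_univ]
  rw [fderiv_symm h.differentiableAt h.symm w u v]
  ring

-- The symbols of the first kind contain one derivative of a C² metric, and inversion is smooth at
-- an invertible map.
set_option maxSynthPendingDepth 3 in
theorem differentiableAt_christoffel (h : IsRegularAt G y) :
    DifferentiableAt ℝ (christoffel G univ) y := by
  have hf : ContDiffAt ℝ 1 (fderiv ℝ G) y := h.contDiffAt.fderiv_right (m := 1) (by norm_num)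
  have hf' : DifferentiableAt ℝ (fderiv ℝ G) y := hf.differentiableAt (by norm_num)
  have hform (u v : E) : DifferentiableAt ℝ (fun z => christoffelForm G univ z u v) y := by
    simp only [christoffelForm, fderivWithin_univ]
    have h1 (u v : E) : DifferentiableAt ℝ (fun z => fderiv ℝ G z u v) y :=
      (hf'.clm_apply (differentiableAt_const u)).clm_apply (differentiableAt_const v)
    have h3 : DifferentiableAt ℝ (fun z => ((fderiv ℝ G z).flip u).flip v) y := by
      -- Moving the differentiation slot to the last place is a continuous linear operation on the
      -- derivative.
      let L : (E →L[ℝ] E →L[ℝ] E →L[ℝ] ℝ) →L[ℝ] (E →L[ℝ] ℝ) :=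
        (ContinuousLinearMap.apply ℝ (E →L[ℝ] ℝ) v) ∘L
          ((ContinuousLinearMap.flipₗᵢ ℝ E E ℝ).toContinuousLinearEquiv :
            (E →L[ℝ] E →L[ℝ] ℝ) →L[ℝ] (E →L[ℝ] E →L[ℝ] ℝ)) ∘L
          (ContinuousLinearMap.apply ℝ (E →L[ℝ] E →L[ℝ] ℝ) u) ∘L
          ((ContinuousLinearMap.flipₗᵢ ℝ E E (E →L[ℝ] ℝ)).toContinuousLinearEquiv :
            (E →L[ℝ] E →L[ℝ] E →L[ℝ] ℝ) →L[ℝ] (E →L[ℝ] E →L[ℝ] E →L[ℝ] ℝ))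
      exact L.differentiableAt.comp y hf'
    exact DifferentiableAt.const_smul (((h1 u v).add (h1 v u)).sub h3) (2⁻¹ : ℝ)
  have hinv : DifferentiableAt ℝ (fun z => (G z).inverse) y :=
    ((isInvertible_of_nondegenerate h.nondegenerate.self_of_nhds).contDiffAt_map_inverse
      (n := 1)).differentiableAt (by norm_num) |>.comp y h.differentiableAt
  have hpt (u v : E) : DifferentiableAt ℝ (fun z => christoffel G univ z u v) y := by
    simp only [christoffel_apply]
    exact hinv.clm_apply (hform u v)
  exact differentiableAt_of_apply fun u => differentiableAt_of_apply fun v => hpt u v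

-- Restriction to lines turns Fréchet derivatives into one-variable ones. Those of a warped field
-- then follow from the product rule and uniqueness of derivatives.
omit [FiniteDimensional ℝ E] in
theorem hasDerivAt_line (h : IsRegularAt G y) (u v w : E) :
    HasDerivAt (fun s : ℝ => G (y + s • u) v w) (fderiv ℝ G y u v w) 0 := by
  have h1 : HasDerivAt (fun s : ℝ => y + s • u) u 0 := by
    simpa using ((hasDerivAt_id (0 : ℝ)).smul_const u).const_add y
  have h2 : HasDerivAt (fun s : ℝ => G (y + s • u)) (fderiv ℝ G y u) 0 :=
    HasFDerivAt.comp_hasDerivAt (l := G) (0 : ℝ) (by simpa using h.differentiableAt.hasFDerivAt) h1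
  simpa using (h2.clm_apply (hasDerivAt_const (0 : ℝ) v)).clm_apply (hasDerivAt_const (0 : ℝ) w)

theorem hasDerivAt_christoffel_line (h : IsRegularAt G y) (u v w : E) :
    HasDerivAt (fun s : ℝ => christoffel G univ (y + s • u) v w)
      (fderiv ℝ (christoffel G univ) y u v w) 0 := by
  have h1 : HasDerivAt (fun s : ℝ => y + s • u) u 0 := by
    simpa using ((hasDerivAt_id (0 : ℝ)).smul_const u).const_add y
  have h2 : HasDerivAt (fun s : ℝ => christoffel G univ (y + s • u))
      (fderiv ℝ (christoffel G univ) y u) 0 :=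
    HasFDerivAt.comp_hasDerivAt (l := christoffel G univ) (0 : ℝ)
      (by simpa using h.differentiableAt_christoffel.hasFDerivAt) h1
  simpa using (h2.clm_apply (hasDerivAt_const (0 : ℝ) v)).clm_apply (hasDerivAt_const (0 : ℝ) w)

end IsRegularAt

/-- R(u, v) is skew in u and v, which are proportional in dimension at most one; no regularity of
the metric enters. -/
theorem ricciCoord_eq_zero_of_finrank_le_one (hE : Module.finrank ℝ E ≤ 1)
    (G : E → E →L[ℝ] E →L[ℝ] ℝ) (s : Set E) (y v w : E) : ricciCoord G s y v w = 0 := by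
  obtain ⟨e, he⟩ := finrank_le_one_iff.1 hE
  have : riemann G s y v w = 0 := by
    ext u
    obtain ⟨a, rfl⟩ := he u
    obtain ⟨b, rfl⟩ := he v
    simp only [riemann, LinearMap.coe_mk, AddHom.coe_mk, map_smul,
      _root_.smul_apply, LinearMap.zero_apply]
    congr 1
    abel
  change LinearMap.trace ℝ E (riemann G s y v w) = 0
  rw [this, map_zero]

theorem scalarCoord_of_einstein {G : E → E →L[ℝ] E →L[ℝ] ℝ} {s : Set E} {y : E} {c : ℝ}
    (hG : ∀ v, (∀ w, G y v w = 0) → v = 0)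
    (h : ∀ v w, ricciCoord G s y v w = c * G y v w) :
    scalarCoord G s y = c * Module.finrank ℝ E := by
  obtain ⟨e, he⟩ := isInvertible_of_nondegenerate hG
  have : (G y).inverse.toLinearMap ∘ₗ
    (LinearMap.toContinuousLinearMap (𝕜 := ℝ) (E := E) (F' := ℝ)).toLinearMap ∘ₗ
      ricciCoord G s y = c • LinearMap.id := by
    ext v
    have h1 : LinearMap.toContinuousLinearMap (ricciCoord G s y v) = c • G y v := by
      ext w
      simp [h]
    simp only [LinearMap.comp_apply, LinearEquiv.coe_coe, h1, ContinuousLinearMap.coe_coe,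
      map_smul, LinearMap.smul_apply, LinearMap.id_apply]
    rw [← he]
    simp
  rw [scalarCoord, this, map_smul, LinearMap.trace_id, smul_eq_mul]

end Coordinates

/-! ### Linear algebra: pull-backs of forms and block traces -/

section Pull

variable {E E' : Type*} [NormedAddCommGroup E] [NormedSpace ℝ E]
  [NormedAddCommGroup E'] [NormedSpace ℝ E']

/-- The pull-back of a bilinear form under a linear map. -/
def pullForm (D : E' →L[ℝ] E) (b : E →L[ℝ] E →L[ℝ] ℝ) : E' →L[ℝ] E' →L[ℝ] ℝ :=
  ContinuousLinearMap.precomp ℝ D ∘L b ∘L D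

theorem pullForm_apply (D : E' →L[ℝ] E) (b : E →L[ℝ] E →L[ℝ] ℝ) (v w : E') :
    pullForm D b v w = b (D v) (D w) := rfl

end Pull

section Trace

variable {E F : Type*} [AddCommGroup E] [Module ℝ E] [FiniteDimensional ℝ E]
  [AddCommGroup F] [Module ℝ F] [FiniteDimensional ℝ F]

/-- The identity is inl ∘ fst + inr ∘ snd, and the trace is cyclic: only the diagonal blocks count.
-/
theorem trace_prod_eq (f : E × F →ₗ[ℝ] E × F) :
    LinearMap.trace ℝ (E × F) f =
      LinearMap.trace ℝ E (LinearMap.fst ℝ E F ∘ₗ f ∘ₗ LinearMap.inl ℝ E F) +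
      LinearMap.trace ℝ F (LinearMap.snd ℝ E F ∘ₗ f ∘ₗ LinearMap.inr ℝ E F) := by
  rw [LinearMap.trace_comp_comm' (f ∘ₗ LinearMap.inl ℝ E F) (LinearMap.fst ℝ E F),
    LinearMap.trace_comp_comm' (f ∘ₗ LinearMap.inr ℝ E F) (LinearMap.snd ℝ E F), ← map_add]
  congr 1
  ext x <;> simp [Prod.mk_zero_zero]

end Trace

/-- `A` is a nonvanishing function near `t` with `A' = 2 α A`, and `α' t = α'`. -/
structure IsLogDerivAt (A α : ℝ → ℝ) (α' t : ℝ) : Prop where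
  contDiffAt : ContDiffAt ℝ 2 A t
  ne_zero : ∀ᶠ s in 𝓝 t, A s ≠ 0
  hasDerivAt : ∀ᶠ s in 𝓝 t, HasDerivAt A (2 * α s * A s) s
  hasDerivAt_log : HasDerivAt α α' t

/-! ### The warped field: nondegeneracy, regularity and first derivative -/

section Warped

variable {E₁ E₂ : Type*} [NormedAddCommGroup E₁] [NormedSpace ℝ E₁]
  [NormedAddCommGroup E₂] [NormedSpace ℝ E₂]

/-- The field `C(t) dt² + A(t) G₁ + B(t) G₂` on `E₁ × E₂ × ℝ`. -/
def warped (C A B : ℝ → ℝ) (G₁ : E₁ → E₁ →L[ℝ] E₁ →L[ℝ] ℝ) (G₂ : E₂ → E₂ →L[ℝ] E₂ →L[ℝ] ℝ)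
    (y : E₁ × E₂ × EuclideanSpace ℝ (Fin 1)) :
    (E₁ × E₂ × EuclideanSpace ℝ (Fin 1)) →L[ℝ] (E₁ × E₂ × EuclideanSpace ℝ (Fin 1)) →L[ℝ] ℝ :=
  let dt : (E₁ × E₂ × EuclideanSpace ℝ (Fin 1)) →L[ℝ] ℝ := EuclideanSpace.proj 0 ∘L
    ContinuousLinearMap.snd ℝ E₂ (EuclideanSpace ℝ (Fin 1)) ∘L
    ContinuousLinearMap.snd ℝ E₁ (E₂ × EuclideanSpace ℝ (Fin 1))
  C (y.2.2 0) • dt.smulRight dt +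
    A (y.2.2 0) • pullForm (ContinuousLinearMap.fst ℝ _ _) (G₁ y.1) +
    B (y.2.2 0) • pullForm (ContinuousLinearMap.fst ℝ _ _ ∘L ContinuousLinearMap.snd ℝ _ _)
      (G₂ y.2.1)

variable {C A B γ α β : ℝ → ℝ} {γ' α' β' : ℝ}
  {G₁ : E₁ → E₁ →L[ℝ] E₁ →L[ℝ] ℝ} {G₂ : E₂ → E₂ →L[ℝ] E₂ →L[ℝ] ℝ}
  {y : E₁ × E₂ × EuclideanSpace ℝ (Fin 1)}

theorem warped_apply (y v w : E₁ × E₂ × EuclideanSpace ℝ (Fin 1)) :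
    warped C A B G₁ G₂ y v w = C (y.2.2 0) * (v.2.2 0 * w.2.2 0) +
      A (y.2.2 0) * G₁ y.1 v.1 w.1 + B (y.2.2 0) * G₂ y.2.1 v.2.1 w.2.1 := by
  simp [warped, pullForm_apply]

theorem warped_nondegenerate (hC : C (y.2.2 0) ≠ 0) (hA : A (y.2.2 0) ≠ 0)
    (hB : B (y.2.2 0) ≠ 0) (h₁ : ∀ v, (∀ w, G₁ y.1 v w = 0) → v = 0)
    (h₂ : ∀ v, (∀ w, G₂ y.2.1 v w = 0) → v = 0) (v : E₁ × E₂ × EuclideanSpace ℝ (Fin 1))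
    (h : ∀ w, warped C A B G₁ G₂ y v w = 0) : v = 0 := by
  simp only [warped_apply] at h
  have e1 : v.1 = 0 := h₁ _ fun w => by
    simpa [hA] using h (w, 0, 0)
  have e2 : v.2.1 = 0 := h₂ _ fun w => by
    simpa [hB] using h (0, w, 0)
  have e3 : v.2.2 = 0 := by
    have := h (0, 0, EuclideanSpace.single 0 1)
    ext i
    fin_cases i
    simpa [hC] using this
  exact Prod.ext e1 (Prod.ext e2 e3)

set_option maxSynthPendingDepth 3 in
theorem contDiffWithinAt_warped {n : ℕ∞ω} {s : Set (E₁ × E₂ × EuclideanSpace ℝ (Fin 1))}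
    (hC : ContDiffAt ℝ n C (y.2.2 0)) (hA : ContDiffAt ℝ n A (y.2.2 0))
    (hB : ContDiffAt ℝ n B (y.2.2 0)) (h₁ : ContDiffAt ℝ n G₁ y.1)
    (h₂ : ContDiffAt ℝ n G₂ y.2.1) : ContDiffWithinAt ℝ n (warped C A B G₁ G₂) s y := by
  have ht : ContDiffAt ℝ n
      (fun y : E₁ × E₂ × EuclideanSpace ℝ (Fin 1) => y.2.2 0) y :=
    ((EuclideanSpace.proj (𝕜 := ℝ) (0 : Fin 1)) ∘L
      ContinuousLinearMap.snd ℝ E₂ (EuclideanSpace ℝ (Fin 1)) ∘L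
      ContinuousLinearMap.snd ℝ E₁ (E₂ × EuclideanSpace ℝ (Fin 1))).contDiff.contDiffAt
  have h1 : ContDiffAt ℝ n (fun y : E₁ × E₂ × EuclideanSpace ℝ (Fin 1) => G₁ y.1) y :=
    ContDiffAt.comp y h₁ contDiffAt_fst
  have h2 : ContDiffAt ℝ n (fun y : E₁ × E₂ × EuclideanSpace ℝ (Fin 1) => G₂ y.2.1) y :=
    ContDiffAt.comp (f := fun y : E₁ × E₂ × EuclideanSpace ℝ (Fin 1) => y.2.1) y h₂ (by fun_prop)
  have h3 (D : (E₁ × E₂ × EuclideanSpace ℝ (Fin 1)) →L[ℝ] E₁) :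
      ContDiffAt ℝ n (fun y : E₁ × E₂ × EuclideanSpace ℝ (Fin 1) => pullForm D (G₁ y.1)) y :=
    contDiffAt_const.clm_comp (h1.clm_comp contDiffAt_const)
  have h4 (D : (E₁ × E₂ × EuclideanSpace ℝ (Fin 1)) →L[ℝ] E₂) :
      ContDiffAt ℝ n (fun y : E₁ × E₂ × EuclideanSpace ℝ (Fin 1) => pullForm D (G₂ y.2.1)) y :=
    contDiffAt_const.clm_comp (h2.clm_comp contDiffAt_const)
  have h5 {f : ℝ → ℝ} (hf : ContDiffAt ℝ n f (y.2.2 0)) : ContDiffAt ℝ n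
      (fun y : E₁ × E₂ × EuclideanSpace ℝ (Fin 1) => f (y.2.2 0)) y :=
    ContDiffAt.comp (g := f) y hf ht
  exact ((((h5 hC).smul contDiffAt_const).add ((h5 hA).smul (h3 _))).add
    ((h5 hB).smul (h4 _))).contDiffWithinAt

theorem IsRegularAt.warped (hC : IsLogDerivAt C γ γ' (y.2.2 0))
    (hA : IsLogDerivAt A α α' (y.2.2 0)) (hB : IsLogDerivAt B β β' (y.2.2 0))
    (h₁ : IsRegularAt G₁ y.1) (h₂ : IsRegularAt G₂ y.2.1) :
    IsRegularAt (warped C A B G₁ G₂) y := by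
  have ht : Tendsto (fun y : E₁ × E₂ × EuclideanSpace ℝ (Fin 1) => y.2.2 0) (𝓝 y)
      (𝓝 (y.2.2 0)) := Continuous.tendsto (by fun_prop) y
  have ht1 : Tendsto (fun y : E₁ × E₂ × EuclideanSpace ℝ (Fin 1) => y.1) (𝓝 y)
      (𝓝 y.1) := Continuous.tendsto (by fun_prop) y
  have ht2 : Tendsto (fun y : E₁ × E₂ × EuclideanSpace ℝ (Fin 1) => y.2.1) (𝓝 y)
      (𝓝 y.2.1) := Continuous.tendsto (by fun_prop) y
  refine ⟨(contDiffWithinAt_univ.1 (contDiffWithinAt_warped hC.contDiffAt hA.contDiffAt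
    hB.contDiffAt h₁.contDiffAt h₂.contDiffAt)), ?_, ?_⟩
  · filter_upwards [ht1.eventually h₁.symm, ht2.eventually h₂.symm] with z h1 h2 v w
    rw [warped_apply, warped_apply, h1 v.1 w.1, h2 v.2.1 w.2.1]
    ring
  · filter_upwards [ht1.eventually h₁.nondegenerate, ht2.eventually h₂.nondegenerate,
      ht.eventually hC.ne_zero, ht.eventually hA.ne_zero, ht.eventually hB.ne_zero]
      with z h1 h2 h3 h4 h5
    exact warped_nondegenerate h3 h4 h5 h1 h2

theorem hasDerivAt_line_coord {f : ℝ → ℝ} {f' t : ℝ} (hf : HasDerivAt f f' t) (k : ℝ) :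
    HasDerivAt (fun s : ℝ => f (t + s * k)) (f' * k) 0 := by
  have h1 : HasDerivAt (fun s : ℝ => t + s * k) k 0 := by
    simpa using ((hasDerivAt_id (0 : ℝ)).mul_const k).const_add t
  exact HasDerivAt.comp (h₂ := f) (0 : ℝ) (by simpa using hf) h1

theorem fderiv_warped (h : IsRegularAt (warped C A B G₁ G₂) y) {C' A' B' : ℝ}
    (hC : HasDerivAt C C' (y.2.2 0)) (hA : HasDerivAt A A' (y.2.2 0))
    (hB : HasDerivAt B B' (y.2.2 0)) (h₁ : IsRegularAt G₁ y.1) (h₂ : IsRegularAt G₂ y.2.1)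
    (u v w : E₁ × E₂ × EuclideanSpace ℝ (Fin 1)) :
    fderiv ℝ (warped C A B G₁ G₂) y u v w =
      C' * u.2.2 0 * (v.2.2 0 * w.2.2 0)
      + (A' * u.2.2 0 * G₁ y.1 v.1 w.1 + A (y.2.2 0) * fderiv ℝ G₁ y.1 u.1 v.1 w.1)
      + (B' * u.2.2 0 * G₂ y.2.1 v.2.1 w.2.1
        + B (y.2.2 0) * fderiv ℝ G₂ y.2.1 u.2.1 v.2.1 w.2.1) := by
  have e1 := h.hasDerivAt_line u v w
  have e2 := (((hasDerivAt_line_coord hC (u.2.2 0)).mul_const (v.2.2 0 * w.2.2 0)).add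
    ((hasDerivAt_line_coord hA (u.2.2 0)).mul (h₁.hasDerivAt_line u.1 v.1 w.1))).add
    ((hasDerivAt_line_coord hB (u.2.2 0)).mul (h₂.hasDerivAt_line u.2.1 v.2.1 w.2.1))
  have e3 := e1.unique (e2.congr_of_eventuallyEq (Eventually.of_forall fun s => by
    simp [warped_apply]))
  simpa using e3

end Warped

/-! ### Christoffel symbols and Ricci tensor of the warped field -/

section Warped

variable {E₁ E₂ : Type*} [NormedAddCommGroup E₁] [NormedSpace ℝ E₁] [FiniteDimensional ℝ E₁]
  [NormedAddCommGroup E₂] [NormedSpace ℝ E₂] [FiniteDimensional ℝ E₂]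
  {C A B γ α β : ℝ → ℝ} {γ' α' β' : ℝ}
  {G₁ : E₁ → E₁ →L[ℝ] E₁ →L[ℝ] ℝ} {G₂ : E₂ → E₂ →L[ℝ] E₂ →L[ℝ] ℝ}
  {y : E₁ × E₂ × EuclideanSpace ℝ (Fin 1)}

theorem riemann_apply (G : E₁ → E₁ →L[ℝ] E₁ →L[ℝ] ℝ) (y v w u : E₁) :
    riemann G univ y v w u =
      fderiv ℝ (christoffel G univ) y u v w - fderiv ℝ (christoffel G univ) y v u w
      + christoffel G univ y u (christoffel G univ y v w)
      - christoffel G univ y v (christoffel G univ y u w) := by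
  simp [riemann, fderivWithin_univ]

/-- The radial component of the Christoffel symbols of `warped`. -/
def radialChristoffel (C A B γ α β : ℝ → ℝ) (G₁ : E₁ → E₁ →L[ℝ] E₁ →L[ℝ] ℝ)
    (G₂ : E₂ → E₂ →L[ℝ] E₂ →L[ℝ] ℝ) (y v w : E₁ × E₂ × EuclideanSpace ℝ (Fin 1)) : ℝ :=
  γ (y.2.2 0) * (v.2.2 0 * w.2.2 0)
    - α (y.2.2 0) * A (y.2.2 0) / C (y.2.2 0) * G₁ y.1 v.1 w.1
    - β (y.2.2 0) * B (y.2.2 0) / C (y.2.2 0) * G₂ y.2.1 v.2.1 w.2.1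

/-- The formula comes from Koszul's: A' = 2αA produces the mixed terms with α, and -A'/(2C) = -αA/C
the radial component on the first factor; likewise for B. It is needed on a neighbourhood because it
is differentiated next. -/
theorem christoffel_warped (hC : IsLogDerivAt C γ γ' (y.2.2 0))
    (hA : IsLogDerivAt A α α' (y.2.2 0)) (hB : IsLogDerivAt B β β' (y.2.2 0))
    (h₁ : IsRegularAt G₁ y.1) (h₂ : IsRegularAt G₂ y.2.1) :
    ∀ᶠ z in 𝓝 y, ∀ v w, christoffel (warped C A B G₁ G₂) univ z v w =
      (christoffel G₁ univ z.1 v.1 w.1 + α (z.2.2 0) • (v.2.2 0 • w.1 + w.2.2 0 • v.1),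
        christoffel G₂ univ z.2.1 v.2.1 w.2.1
          + β (z.2.2 0) • (v.2.2 0 • w.2.1 + w.2.2 0 • v.2.1),
        radialChristoffel C A B γ α β G₁ G₂ z v w • EuclideanSpace.single 0 1) := by
  have h := IsRegularAt.warped hC hA hB h₁ h₂
  have ht : Tendsto (fun y : E₁ × E₂ × EuclideanSpace ℝ (Fin 1) => y.2.2 0) (𝓝 y)
      (𝓝 (y.2.2 0)) := Continuous.tendsto (by fun_prop) y
  have ht1 : Tendsto (fun y : E₁ × E₂ × EuclideanSpace ℝ (Fin 1) => y.1) (𝓝 y)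
      (𝓝 y.1) := Continuous.tendsto (by fun_prop) y
  have ht2 : Tendsto (fun y : E₁ × E₂ × EuclideanSpace ℝ (Fin 1) => y.2.1) (𝓝 y)
      (𝓝 y.2.1) := Continuous.tendsto (by fun_prop) y
  filter_upwards [h.eventually, ht1.eventually h₁.eventually, ht2.eventually h₂.eventually,
    ht.eventually hC.ne_zero, ht.eventually hC.hasDerivAt, ht.eventually hA.hasDerivAt,
    ht.eventually hB.hasDerivAt] with z hz hz1 hz2 hC0 hC1 hA1 hB1 v w
  refine christoffel_eq hz.nondegenerate.self_of_nhds fun x => ?_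
  rw [christoffelForm_apply, fderivWithin_univ, warped_apply]
  simp only [fderiv_warped hz hC1 hA1 hB1 hz1 hz2, map_add, map_smul, add_apply,
    smul_apply, map_christoffel hz1.nondegenerate.self_of_nhds,
    map_christoffel hz2.nondegenerate.self_of_nhds, christoffelForm_apply, fderivWithin_univ,
    radialChristoffel, smul_eq_mul, PiLp.smul_apply, PiLp.single_apply, if_true]
  field_simp
  ring

theorem fderiv_christoffel_warped (hC : IsLogDerivAt C γ γ' (y.2.2 0))
    (hA : IsLogDerivAt A α α' (y.2.2 0)) (hB : IsLogDerivAt B β β' (y.2.2 0))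
    (h₁ : IsRegularAt G₁ y.1) (h₂ : IsRegularAt G₂ y.2.1)
    (u v w : E₁ × E₂ × EuclideanSpace ℝ (Fin 1)) :
    fderiv ℝ (christoffel (warped C A B G₁ G₂) univ) y u v w =
      (fderiv ℝ (christoffel G₁ univ) y.1 u.1 v.1 w.1
          + (α' * u.2.2 0) • (v.2.2 0 • w.1 + w.2.2 0 • v.1),
        fderiv ℝ (christoffel G₂ univ) y.2.1 u.2.1 v.2.1 w.2.1
          + (β' * u.2.2 0) • (v.2.2 0 • w.2.1 + w.2.2 0 • v.2.1),
        (γ' * u.2.2 0 * (v.2.2 0 * w.2.2 0)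
          - ((α' + 2 * α (y.2.2 0) ^ 2 - 2 * α (y.2.2 0) * γ (y.2.2 0)) * A (y.2.2 0)
              / C (y.2.2 0) * u.2.2 0 * G₁ y.1 v.1 w.1
            + α (y.2.2 0) * A (y.2.2 0) / C (y.2.2 0) * fderiv ℝ G₁ y.1 u.1 v.1 w.1)
          - ((β' + 2 * β (y.2.2 0) ^ 2 - 2 * β (y.2.2 0) * γ (y.2.2 0)) * B (y.2.2 0)
              / C (y.2.2 0) * u.2.2 0 * G₂ y.2.1 v.2.1 w.2.1
            + β (y.2.2 0) * B (y.2.2 0) / C (y.2.2 0) * fderiv ℝ G₂ y.2.1 u.2.1 v.2.1 w.2.1))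
          • EuclideanSpace.single 0 1) := by
  have h := IsRegularAt.warped hC hA hB h₁ h₂
  have e1 := h.hasDerivAt_christoffel_line u v w
  -- Quotient rule for φf/C, with f' = 2φf and C' = 2γC substituted.
  have hcoef {f φ : ℝ → ℝ} {φ' : ℝ} (hf : IsLogDerivAt f φ φ' (y.2.2 0)) :
      HasDerivAt (fun t => φ t * f t / C t)
        ((φ' + 2 * φ (y.2.2 0) ^ 2 - 2 * φ (y.2.2 0) * γ (y.2.2 0)) * f (y.2.2 0)
              / C (y.2.2 0)) (y.2.2 0) := by
    have := (hf.hasDerivAt_log.mul hf.hasDerivAt.self_of_nhds).div hC.hasDerivAt.self_of_nhds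
      hC.ne_zero.self_of_nhds
    refine this.congr_deriv ?_
    have := hC.ne_zero.self_of_nhds
    simp only [Pi.mul_apply]
    field_simp
  have d1 := (h₁.hasDerivAt_christoffel_line u.1 v.1 w.1).add
    ((hasDerivAt_line_coord hA.hasDerivAt_log (u.2.2 0)).smul_const
      (v.2.2 0 • w.1 + w.2.2 0 • v.1))
  have d2 := (h₂.hasDerivAt_christoffel_line u.2.1 v.2.1 w.2.1).add
    ((hasDerivAt_line_coord hB.hasDerivAt_log (u.2.2 0)).smul_const
      (v.2.2 0 • w.2.1 + w.2.2 0 • v.2.1))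
  have d3 := ((((hasDerivAt_line_coord hC.hasDerivAt_log (u.2.2 0)).mul_const
    (v.2.2 0 * w.2.2 0)).sub
    ((hasDerivAt_line_coord (hcoef hA) (u.2.2 0)).mul (h₁.hasDerivAt_line u.1 v.1 w.1))).sub
    ((hasDerivAt_line_coord (hcoef hB) (u.2.2 0)).mul
      (h₂.hasDerivAt_line u.2.1 v.2.1 w.2.1))).smul_const
      (EuclideanSpace.single (0 : Fin 1) (1 : ℝ))
  have hline : Tendsto (fun s : ℝ => y + s • u) (𝓝 0) (𝓝 y) := by
    have : Continuous fun s : ℝ => y + s • u := by fun_prop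
    simpa using this.tendsto 0
  have e2 := (d1.prodMk (d2.prodMk d3)).congr_of_eventuallyEq
    (f₁ := fun s : ℝ => christoffel (warped C A B G₁ G₂) univ (y + s • u) v w) (by
      filter_upwards [hline.eventually (christoffel_warped hC hA hB h₁ h₂)] with s hs
      rw [hs v w]
      simp [radialChristoffel])
  rw [e1.unique e2]
  simp

/-- The trace of u ↦ R(u, v)w is the sum over its three diagonal blocks. On each of the factors E₁
and E₂ the block is the curvature of that factor plus a multiple of the identity plus a rank-one
map; the radial block is a scalar. -/
theorem ricciCoord_warped (hC : IsLogDerivAt C γ γ' (y.2.2 0))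
    (hA : IsLogDerivAt A α α' (y.2.2 0)) (hB : IsLogDerivAt B β β' (y.2.2 0))
    (h₁ : IsRegularAt G₁ y.1) (h₂ : IsRegularAt G₂ y.2.1)
    (v w : E₁ × E₂ × EuclideanSpace ℝ (Fin 1)) :
    ricciCoord (warped C A B G₁ G₂) univ y v w =
      ricciCoord G₁ univ y.1 v.1 w.1 + ricciCoord G₂ univ y.2.1 v.2.1 w.2.1
      + (Module.finrank ℝ E₁ * (α (y.2.2 0) * γ (y.2.2 0) - α' - α (y.2.2 0) ^ 2)
        + Module.finrank ℝ E₂ * (β (y.2.2 0) * γ (y.2.2 0) - β' - β (y.2.2 0) ^ 2))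
          * (v.2.2 0 * w.2.2 0)
      + (α (y.2.2 0) * γ (y.2.2 0) - α' - Module.finrank ℝ E₁ * α (y.2.2 0) ^ 2
        - Module.finrank ℝ E₂ * α (y.2.2 0) * β (y.2.2 0)) * A (y.2.2 0) / C (y.2.2 0)
          * G₁ y.1 v.1 w.1
      + (β (y.2.2 0) * γ (y.2.2 0) - β' - Module.finrank ℝ E₂ * β (y.2.2 0) ^ 2
        - Module.finrank ℝ E₁ * α (y.2.2 0) * β (y.2.2 0)) * B (y.2.2 0) / C (y.2.2 0)
          * G₂ y.2.1 v.2.1 w.2.1 := by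
  have hΓ := (christoffel_warped hC hA hB h₁ h₂).self_of_nhds
  have hR (u : E₁ × E₂ × EuclideanSpace ℝ (Fin 1)) :=
    riemann_apply (warped C A B G₁ G₂) y v w u
  simp only [fderiv_christoffel_warped hC hA hB h₁ h₂, hΓ] at hR
  have b1 : LinearMap.fst ℝ _ _ ∘ₗ riemann (warped C A B G₁ G₂) univ y v w ∘ₗ
      LinearMap.inl ℝ _ _ = riemann G₁ univ y.1 v.1 w.1
        + ((- α' - α (y.2.2 0) ^ 2) * (v.2.2 0 * w.2.2 0)
            + α (y.2.2 0) * radialChristoffel C A B γ α β G₁ G₂ y v w) • LinearMap.id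
        + (α (y.2.2 0) ^ 2 * A (y.2.2 0) / C (y.2.2 0)) •
          (G₁ y.1 w.1).toLinearMap.smulRight v.1 := by
    ext u
    simp [hR, radialChristoffel, riemann_apply G₁, h₁.christoffel_comm v.1 u,
      h₁.symm.self_of_nhds u w.1, smul_smul]
    module
  have b2 : LinearMap.fst ℝ _ _ ∘ₗ (LinearMap.snd ℝ _ _ ∘ₗ
      riemann (warped C A B G₁ G₂) univ y v w ∘ₗ
      LinearMap.inr ℝ _ _) ∘ₗ LinearMap.inl ℝ _ _ = riemann G₂ univ y.2.1 v.2.1 w.2.1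
        + ((- β' - β (y.2.2 0) ^ 2) * (v.2.2 0 * w.2.2 0)
            + β (y.2.2 0) * radialChristoffel C A B γ α β G₁ G₂ y v w) • LinearMap.id
        + (β (y.2.2 0) ^ 2 * B (y.2.2 0) / C (y.2.2 0)) •
          (G₂ y.2.1 w.2.1).toLinearMap.smulRight v.2.1 := by
    ext u
    simp [hR, radialChristoffel, riemann_apply G₂, h₂.christoffel_comm v.2.1 u,
      h₂.symm.self_of_nhds u w.2.1]
    module
  -- The derivatives of `G₁` and `G₂` occur only in the radial component; for radial u they are
  -- evaluated on a zero vector and disappear.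
  have b3 : LinearMap.snd ℝ _ _ ∘ₗ (LinearMap.snd ℝ _ _ ∘ₗ
      riemann (warped C A B G₁ G₂) univ y v w ∘ₗ
      LinearMap.inr ℝ _ _) ∘ₗ LinearMap.inr ℝ _ _ =
        ((α (y.2.2 0) * γ (y.2.2 0) - α' - α (y.2.2 0) ^ 2) * A (y.2.2 0) / C (y.2.2 0)
            * G₁ y.1 v.1 w.1
          + (β (y.2.2 0) * γ (y.2.2 0) - β' - β (y.2.2 0) ^ 2) * B (y.2.2 0) / C (y.2.2 0)
            * G₂ y.2.1 v.2.1 w.2.1) • LinearMap.id := by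
    refine LinearMap.ext fun u => ?_
    ext i
    fin_cases i
    simp [hR, radialChristoffel]
    ring
  change LinearMap.trace ℝ _ (riemann (warped C A B G₁ G₂) univ y v w) =
    LinearMap.trace ℝ _ (riemann G₁ univ y.1 v.1 w.1) +
    LinearMap.trace ℝ _ (riemann G₂ univ y.2.1 v.2.1 w.2.1) + _ + _ + _
  rw [trace_prod_eq, trace_prod_eq, b1, b2, b3]
  simp only [map_add, map_smul, LinearMap.trace_id, LinearMap.trace_smulRight, smul_eq_mul,
    ContinuousLinearMap.coe_coe, finrank_euclideanSpace_fin, radialChristoffel,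
    h₁.symm.self_of_nhds w.1, h₂.symm.self_of_nhds w.2.1]
  have := hC.ne_zero.self_of_nhds
  field_simp
  push_cast
  ring

end Warped

/-! ### Fields of forms on manifolds and their expressions in charts -/

section Manifolds

variable {E : Type*} [NormedAddCommGroup E] [NormedSpace ℝ E]
  {H : Type*} [TopologicalSpace H] {I : ModelWithCorners ℝ E H}
  {M : Type*} [TopologicalSpace M] [ChartedSpace H M]

theorem inChart_apply (g : BilinField I M) (x₀ : M) (y v w : E) :
    inChart I g x₀ y v w = g ((extChartAt I x₀).symm y)
      (mfderivWithin 𝓘(ℝ, E) I (extChartAt I x₀).symm (range I) y v)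
      (mfderivWithin 𝓘(ℝ, E) I (extChartAt I x₀).symm (range I) y w) := rfl

/-- At the centre of its own preferred chart, the differential of the inverse chart is the identity
of the model space. -/
theorem inChart_self [IsManifold I 1 M] (g : BilinField I M) (x : M) (v w : TangentSpace I x) :
    inChart I g x (extChartAt I x x) v w = g x v w := by
  have hD : (mfderivWithin 𝓘(ℝ, E) I (extChartAt I x).symm (range I) (extChartAt I x x) :
      E →L[ℝ] E) = ContinuousLinearMap.id ℝ E := by
    have h1 := TangentBundle.symmL_trivializationAt (I := I) (mem_chart_source H x)
    rw [TangentBundle.symmL_trivializationAt_eq_core (mem_chart_source H x)] at h1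
    refine h1.symm.trans ?_
    ext v
    exact (tangentBundleCore I M).coordChange_self (achart H x) x (mem_achart_source H x) v
  have hx := extChartAt_to_inv (I := I) x
  -- The base point is equal to `x` only propositionally, so it is generalized before substituting.
  have key : ∀ (x' : M) (D : E →L[ℝ] E), x' = x → D = ContinuousLinearMap.id ℝ E →
      (g x' : E →L[ℝ] E →L[ℝ] ℝ) (D v) (D w) = g x v w := by
    rintro _ _ rfl rfl
    rfl
  exact key _ _ hx hD

theorem inChart_extChartAt [IsManifold I 1 M] (g : BilinField I M) {x₀ x : M}
    (hx : x ∈ (chartAt H x₀).source) (v w : E) :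
    inChart I g x₀ (extChartAt I x₀ x) v w =
      g x ((trivializationAt E (TangentSpace I) x₀).symm x v)
        ((trivializationAt E (TangentSpace I) x₀).symm x w) := by
  have h1 := TangentBundle.symmL_trivializationAt (I := I) hx
  have h2 (v : E) : (trivializationAt E (TangentSpace I) x₀).symm x v =
      mfderivWithin 𝓘(ℝ, E) I (extChartAt I x₀).symm (range I) (extChartAt I x₀ x) v := by
    rw [← Bundle.Trivialization.symmL_apply (R := ℝ), h1]
    · rfl
    · exact hx
  rw [inChart_apply]
  have key : ∀ (x' : M) (v w : E), x' = x →
      (g x' : E →L[ℝ] E →L[ℝ] ℝ) v w = (g x : E →L[ℝ] E →L[ℝ] ℝ) v w := by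
    rintro _ _ _ rfl
    rfl
  rw [h2, h2]
  exact key _ _ _ ((extChartAt I x₀).left_inv (by rwa [extChartAt_source]))

/-- The trivialization of the bundle of forms is induced by that of the tangent bundle, whose
inverse on fibres is the differential of the inverse chart. So the local representative of the
section is `inChart` composed with the chart. -/
theorem contMDiffAt_bilinField_iff [IsManifold I 1 M] (g : BilinField I M) (x₀ : M) {n : ℕ∞ω} :
    ContMDiffAt I (I.prod 𝓘(ℝ, E →L[ℝ] E →L[ℝ] ℝ)) n
      (fun x => Bundle.TotalSpace.mk' (E →L[ℝ] E →L[ℝ] ℝ)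
        (E := fun x : M => TangentSpace I x →L[ℝ] TangentSpace I x →L[ℝ] ℝ) x (g x)) x₀ ↔
    ContDiffWithinAt ℝ n (inChart I g x₀) (range I) (extChartAt I x₀ x₀) := by
  rw [contMDiffAt_hom_bundle]
  refine (and_iff_right contMDiffAt_id).trans ?_
  have h1 : (fun x => ContinuousLinearMap.inCoordinates E (TangentSpace I) (E →L[ℝ] ℝ)
      (fun x : M => TangentSpace I x →L[ℝ] ℝ) x₀ x x₀ x (g x)) =ᶠ[𝓝 x₀]
      inChart I g x₀ ∘ extChartAt I x₀ := by
    filter_upwards [(chartAt H x₀).open_source.mem_nhds (mem_chart_source H x₀)] with x hx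
    ext v w
    rw [Function.comp_apply, inChart_extChartAt g hx]
    refine (inCoordinates_apply_eq₂ (𝕜 := ℝ) (F₁ := E) (F₂ := E)
      (E₁ := (TangentSpace I : M → Type _)) (E₂ := (TangentSpace I : M → Type _)) (F₃ := ℝ)
      (E₃ := Bundle.Trivial M ℝ) (ϕ := g x) hx hx (mem_univ x)).trans ?_
    exact congrArg (fun L : ℝ →ₗ[ℝ] ℝ => L _)
      (Bundle.Trivial.linearMapAt_trivialization ℝ M ℝ x)
  rw [h1.contMDiffAt_iff, contMDiffAt_iff_source, ← contMDiffWithinAt_iff_contDiffWithinAt]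
  refine Filter.EventuallyEq.contMDiffWithinAt_iff ?_ ?_
  · filter_upwards [extChartAt_target_mem_nhdsWithin x₀] with y hy
    simp only [Function.comp_apply, (extChartAt I x₀).right_inv hy]
  · simp only [Function.comp_apply, extChartAt_to_inv]

end Manifolds

section Manifolds

variable {E : Type*} [NormedAddCommGroup E] [NormedSpace ℝ E]
  {H : Type*} [TopologicalSpace H] {I : ModelWithCorners ℝ E H}
  {M : Type*} [TopologicalSpace M] [ChartedSpace H M]

theorem mfderiv_mfderivWithin_extChartAt_symm [IsManifold I 1 M] {E' : Type*}
    [NormedAddCommGroup E'] [NormedSpace ℝ E'] {H' : Type*} [TopologicalSpace H']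
    {J : ModelWithCorners ℝ E' H'} {N : Type*} [TopologicalSpace N] [ChartedSpace H' N]
    {f : M → N} {x₀ : M} {y : E} (hy : y ∈ (extChartAt I x₀).target)
    (hf : MDifferentiableAt I J f ((extChartAt I x₀).symm y)) (v : E) :
    mfderiv I J f ((extChartAt I x₀).symm y)
        (mfderivWithin 𝓘(ℝ, E) I (extChartAt I x₀).symm (range I) y v) =
      mfderivWithin 𝓘(ℝ, E) J (f ∘ (extChartAt I x₀).symm) (range I) y v := by
  have hu : UniqueMDiffWithinAt 𝓘(ℝ, E) (range I) y :=
    (I.uniqueDiffOn y (extChartAt_target_subset_range x₀ hy)).uniqueMDiffWithinAt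
  rw [mfderiv_comp_mfderivWithin y hf (mdifferentiableWithinAt_extChartAt_symm hy) hu]
  rfl

theorem IsMetricOn.isRegularAt_inChart [FiniteDimensional ℝ E] [I.Boundaryless]
    [IsManifold I 1 M] {p q : ℕ} {g : BilinField I M} (hg : IsMetricOn I univ p q g) (x : M) :
    IsRegularAt (inChart I g x) (extChartAt I x x) where
  contDiffAt := by
    have h := (contMDiffAt_bilinField_iff g x).1
      ((hg.smooth x (mem_univ x)).contMDiffAt univ_mem)
    rw [I.range_eq_univ, contDiffWithinAt_univ] at h
    exact h.of_le ENat.LEInfty.out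
  symm := Eventually.of_forall fun y v w => by
    rw [inChart_apply, inChart_apply]
    exact hg.symm _ (mem_univ _) _ _
  nondegenerate := by
    filter_upwards [extChartAt_target_mem_nhds x] with y hy v hv
    have key : ∀ (B : E →L[ℝ] E →L[ℝ] ℝ) (D : E →L[ℝ] E), D.IsInvertible →
        (∀ v, (∀ w, B v w = 0) → v = 0) → ∀ v, (∀ w, B (D v) (D w) = 0) → v = 0 := by
      rintro B _ ⟨e, rfl⟩ hB v hv
      simpa using hB (e v) fun w => by simpa using hv (e.symm w)
    exact key _ _ (isInvertible_mfderivWithin_extChartAt_symm (I := I) hy)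
      (hg.nondegenerate ((extChartAt I x).symm y) (mem_univ _)) v hv

theorem IsMetricOn.contDiffAt_inChart [I.Boundaryless] [IsManifold I 1 M] {p q : ℕ}
    {g : BilinField I M} (hg : IsMetricOn I univ p q g) (x : M) :
    ContDiffAt ℝ ∞ (inChart I g x) (extChartAt I x x) := by
  have h := (contMDiffAt_bilinField_iff g x).1 ((hg.smooth x (mem_univ x)).contMDiffAt univ_mem)
  rwa [I.range_eq_univ, contDiffWithinAt_univ] at h

theorem bilinField_congr (g : BilinField I M) {x x' : M} (h : x = x') {v v' w w' : E}
    (hv : v = v') (hw : w = w') :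
    (g x : E →L[ℝ] E →L[ℝ] ℝ) v w = (g x' : E →L[ℝ] E →L[ℝ] ℝ) v' w' := by
  subst h hv hw
  rfl

/-- Charts of an open subset of the model space are restrictions of the identity; this makes
`radius` a literal coordinate. -/
theorem extChartAt_symm_opens_model {U : TopologicalSpace.Opens H} {t : U} {y : E}
    (hy : y ∈ (extChartAt I t).target) : I ((extChartAt I t).symm y).1 = y :=
  (extChartAt I t).right_inv hy

end Manifolds

/-! ### The warped field on M₁ × M₂ × I in product charts -/

section SubProduct

variable {m₁ m₂ : ℕ} {M₁ M₂ : Type*}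
  [TopologicalSpace M₁] [ChartedSpace (EuclideanSpace ℝ (Fin m₁)) M₁]
  [TopologicalSpace M₂] [ChartedSpace (EuclideanSpace ℝ (Fin m₂)) M₂] {μ : ℝ}

/-- The field `C(r) dr² + A(r) g₁ + B(r) g₂` on `M₁ × M₂ × I`. -/
def warpedField (C A B : ℝ → ℝ) (g₁ : BilinField (𝓡 m₁) M₁) (g₂ : BilinField (𝓡 m₂) M₂) (μ : ℝ) :
    BilinField (subProductModel m₁ m₂) (SubProduct m₂ M₁ M₂ μ) :=
  fun z => C (radius m₂ μ z) • dSq (subProductModel m₁ m₂) (radius m₂ μ) z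
    + A (radius m₂ μ z) • pullback (subProductModel m₁ m₂) (𝓡 m₁) (fun z => z.1) g₁ z
    + B (radius m₂ μ z) • pullback (subProductModel m₁ m₂) (𝓡 m₂) (fun z => z.2.1) g₂ z

theorem warpedField_apply (C A B : ℝ → ℝ) (g₁ : BilinField (𝓡 m₁) M₁) (g₂ : BilinField (𝓡 m₂) M₂)
    (z : SubProduct m₂ M₁ M₂ μ) (v w : TangentSpace (subProductModel m₁ m₂) z) :
    warpedField C A B g₁ g₂ μ z v w =
      let dr : TangentSpace (subProductModel m₁ m₂) z →L[ℝ] ℝ :=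
        mfderiv (subProductModel m₁ m₂) 𝓘(ℝ, ℝ) (radius m₂ μ) z
      C (radius m₂ μ z) * (dr v * dr w)
        + A (radius m₂ μ z) * g₁ z.1
          (mfderiv (subProductModel m₁ m₂) (𝓡 m₁) (fun z : SubProduct m₂ M₁ M₂ μ => z.1) z v)
          (mfderiv (subProductModel m₁ m₂) (𝓡 m₁) (fun z : SubProduct m₂ M₁ M₂ μ => z.1) z w)
        + B (radius m₂ μ z) * g₂ z.2.1
          (mfderiv (subProductModel m₁ m₂) (𝓡 m₂) (fun z : SubProduct m₂ M₁ M₂ μ => z.2.1) z v)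
          (mfderiv (subProductModel m₁ m₂) (𝓡 m₂) (fun z : SubProduct m₂ M₁ M₂ μ => z.2.1) z w) :=
  rfl

theorem contMDiff_radius :
    ContMDiff (subProductModel m₁ m₂) 𝓘(ℝ, ℝ) ∞ (radius (M₁ := M₁) (M₂ := M₂) m₂ μ) := by
  have h1 : ContMDiff (𝓡∂ 1) 𝓘(ℝ, ℝ) ∞
      (fun t : radialDomain μ m₂ => (EuclideanSpace.proj (𝕜 := ℝ) (0 : Fin 1)) ((𝓡∂ 1) t.1)) :=
    (EuclideanSpace.proj (𝕜 := ℝ) (0 : Fin 1)).contMDiff.comp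
      ((𝓡∂ 1).contMDiff.comp contMDiff_subtype_val)
  exact h1.comp (contMDiff_snd.comp contMDiff_snd)

variable [IsManifold (𝓡 m₁) ∞ M₁] [IsManifold (𝓡 m₂) ∞ M₂]

/-- The chart of the product is the product of the charts, so the differentials of the projections
and of `radius` become linear coordinate projections, by the chain rule. -/
theorem inChart_warpedField (C A B : ℝ → ℝ) (g₁ : BilinField (𝓡 m₁) M₁)
    (g₂ : BilinField (𝓡 m₂) M₂) (z : SubProduct m₂ M₁ M₂ μ)
    {y : EuclideanSpace ℝ (Fin m₁) × EuclideanSpace ℝ (Fin m₂) × EuclideanSpace ℝ (Fin 1)}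
    (hy : y ∈ (extChartAt (subProductModel m₁ m₂) z).target) :
    inChart (subProductModel m₁ m₂) (warpedField C A B g₁ g₂ μ) z y =
      warped C A B (inChart (𝓡 m₁) g₁ z.1) (inChart (𝓡 m₂) g₂ z.2.1) y := by
  have hext : extChartAt (subProductModel m₁ m₂) z = (extChartAt (𝓡 m₁) z.1).prod
      ((extChartAt (𝓡 m₂) z.2.1).prod (extChartAt (𝓡∂ 1) z.2.2)) := by
    rw [extChartAt_prod, extChartAt_prod]
  have hy' := hy
  rw [hext] at hy'
  obtain ⟨hy1, hy2, hy3⟩ : y.1 ∈ (extChartAt (𝓡 m₁) z.1).target ∧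
    y.2.1 ∈ (extChartAt (𝓡 m₂) z.2.1).target ∧ y.2.2 ∈ (extChartAt (𝓡∂ 1) z.2.2).target := hy'
  have hs1 (y) : ((extChartAt (subProductModel m₁ m₂) z).symm y).1 =
      (extChartAt (𝓡 m₁) z.1).symm y.1 := by rw [hext]; rfl
  have hs2 (y) : ((extChartAt (subProductModel m₁ m₂) z).symm y).2.1 =
      (extChartAt (𝓡 m₂) z.2.1).symm y.2.1 := by rw [hext]; rfl
  have hs3 {y} (hy : y ∈ (extChartAt (subProductModel m₁ m₂) z).target) :
      radius m₂ μ ((extChartAt (subProductModel m₁ m₂) z).symm y) = y.2.2 0 := by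
    rw [hext] at hy ⊢
    exact congrArg (fun t : EuclideanSpace ℝ (Fin 1) => t 0)
      (extChartAt_symm_opens_model (I := 𝓡∂ 1) hy.2.2)
  have hu : UniqueMDiffWithinAt 𝓘(ℝ, EuclideanSpace ℝ (Fin m₁) × EuclideanSpace ℝ (Fin m₂) ×
      EuclideanSpace ℝ (Fin 1)) (range (subProductModel m₁ m₂)) y :=
    ((subProductModel m₁ m₂).uniqueDiffOn y
      (extChartAt_target_subset_range z hy)).uniqueMDiffWithinAt
  have d1 (v) : (mfderiv (subProductModel m₁ m₂) (𝓡 m₁) (fun z : SubProduct m₂ M₁ M₂ μ => z.1)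
      ((extChartAt (subProductModel m₁ m₂) z).symm y)
      (mfderivWithin 𝓘(ℝ, EuclideanSpace ℝ (Fin m₁) × EuclideanSpace ℝ (Fin m₂) ×
      EuclideanSpace ℝ (Fin 1)) (subProductModel m₁ m₂)
        (extChartAt (subProductModel m₁ m₂) z).symm (range (subProductModel m₁ m₂)) y v) :
        EuclideanSpace ℝ (Fin m₁)) =
      mfderivWithin (𝓡 m₁) (𝓡 m₁) (extChartAt (𝓡 m₁) z.1).symm (range (𝓡 m₁)) y.1 v.1 := by
    refine (mfderiv_mfderivWithin_extChartAt_symm hy mdifferentiableAt_fst v).trans ?_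
    rw [show ((fun z : SubProduct m₂ M₁ M₂ μ => z.1) ∘
      (extChartAt (subProductModel m₁ m₂) z).symm) = (extChartAt (𝓡 m₁) z.1).symm ∘ Prod.fst from
      funext hs1, mfderivWithin_comp y (mdifferentiableWithinAt_extChartAt_symm hy1)
        (I' := 𝓡 m₁) (u := range (𝓡 m₁))
        differentiableWithinAt_fst.mdifferentiableWithinAt (fun _ _ => by simp) hu,
      mfderivWithin_eq_fderivWithin, fderivWithin_fst hu.uniqueDiffWithinAt]
    rfl
  have d2 (v) : (mfderiv (subProductModel m₁ m₂) (𝓡 m₂) (fun z : SubProduct m₂ M₁ M₂ μ => z.2.1)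
      ((extChartAt (subProductModel m₁ m₂) z).symm y)
      (mfderivWithin 𝓘(ℝ, EuclideanSpace ℝ (Fin m₁) × EuclideanSpace ℝ (Fin m₂) ×
      EuclideanSpace ℝ (Fin 1)) (subProductModel m₁ m₂)
        (extChartAt (subProductModel m₁ m₂) z).symm (range (subProductModel m₁ m₂)) y v) :
        EuclideanSpace ℝ (Fin m₂)) =
      mfderivWithin (𝓡 m₂) (𝓡 m₂) (extChartAt (𝓡 m₂) z.2.1).symm (range (𝓡 m₂)) y.2.1 v.2.1 := by
    refine (mfderiv_mfderivWithin_extChartAt_symm hy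
      (mdifferentiableAt_fst.comp _ mdifferentiableAt_snd) v).trans ?_
    have hd : HasFDerivWithinAt (fun y : EuclideanSpace ℝ (Fin m₁) × EuclideanSpace ℝ (Fin m₂) ×
        EuclideanSpace ℝ (Fin 1) => y.2.1) (ContinuousLinearMap.fst ℝ _ _ ∘L
          ContinuousLinearMap.snd ℝ _ _) (range (subProductModel m₁ m₂)) y :=
      (ContinuousLinearMap.fst ℝ (EuclideanSpace ℝ (Fin m₂)) (EuclideanSpace ℝ (Fin 1)) ∘L
        ContinuousLinearMap.snd ℝ (EuclideanSpace ℝ (Fin m₁))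
          (EuclideanSpace ℝ (Fin m₂) × EuclideanSpace ℝ (Fin 1))).hasFDerivWithinAt
    rw [show ((Prod.fst ∘ Prod.snd : SubProduct m₂ M₁ M₂ μ → M₂) ∘
      (extChartAt (subProductModel m₁ m₂) z).symm) = (extChartAt (𝓡 m₂) z.2.1).symm ∘
        (fun y => y.2.1) from
      funext hs2, mfderivWithin_comp y (mdifferentiableWithinAt_extChartAt_symm hy2)
        (I' := 𝓡 m₂) (u := range (𝓡 m₂))
        hd.differentiableWithinAt.mdifferentiableWithinAt (fun _ _ => by simp) hu,
      mfderivWithin_eq_fderivWithin, hd.fderivWithin hu.uniqueDiffWithinAt]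
    rfl
  have d3 (v) : (mfderiv (subProductModel m₁ m₂) 𝓘(ℝ, ℝ) (radius (M₁ := M₁) (M₂ := M₂) m₂ μ)
      ((extChartAt (subProductModel m₁ m₂) z).symm y)
      (mfderivWithin 𝓘(ℝ, EuclideanSpace ℝ (Fin m₁) × EuclideanSpace ℝ (Fin m₂) ×
      EuclideanSpace ℝ (Fin 1)) (subProductModel m₁ m₂)
        (extChartAt (subProductModel m₁ m₂) z).symm (range (subProductModel m₁ m₂)) y v) : ℝ) =
      v.2.2 0 := by
    refine (mfderiv_mfderivWithin_extChartAt_symm hy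
      (contMDiff_radius.mdifferentiableAt (by simp)) v).trans ?_
    have hd : HasFDerivWithinAt (fun y : EuclideanSpace ℝ (Fin m₁) × EuclideanSpace ℝ (Fin m₂) ×
        EuclideanSpace ℝ (Fin 1) => y.2.2 0) (EuclideanSpace.proj (0 : Fin 1) ∘L
          ContinuousLinearMap.snd ℝ _ _ ∘L ContinuousLinearMap.snd ℝ _ _)
          (range (subProductModel m₁ m₂)) y :=
      (EuclideanSpace.proj (0 : Fin 1) ∘L ContinuousLinearMap.snd ℝ (EuclideanSpace ℝ (Fin m₂))
          (EuclideanSpace ℝ (Fin 1)) ∘L ContinuousLinearMap.snd ℝ (EuclideanSpace ℝ (Fin m₁))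
          (EuclideanSpace ℝ (Fin m₂) × EuclideanSpace ℝ (Fin 1))).hasFDerivWithinAt
    -- For `radius` the coordinate formula is available only on the chart target, so the functions
    -- agree merely near `y` within the range of the model.
    have heq : (radius (M₁ := M₁) (M₂ := M₂) m₂ μ) ∘ (extChartAt (subProductModel m₁ m₂) z).symm
        =ᶠ[𝓝[range (subProductModel m₁ m₂)] y] fun y => y.2.2 0 := by
      filter_upwards [extChartAt_target_mem_nhdsWithin_of_mem hy] with y hy using hs3 hy
    rw [mfderivWithin_eq_fderivWithin, heq.fderivWithin_eq (hs3 hy),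
      hd.fderivWithin hu.uniqueDiffWithinAt]
    rfl
  refine ContinuousLinearMap.ext fun v => ContinuousLinearMap.ext fun w => ?_
  rw [inChart_apply, warped_apply]
  refine (warpedField_apply C A B g₁ g₂ _ _ _).trans ?_
  refine congrArg₂ (· + ·) (congrArg₂ (· + ·) ?_ ?_) ?_
  · exact congrArg₂ (· * ·) (congrArg C (hs3 hy)) (congrArg₂ (· * ·) (d3 v) (d3 w))
  · exact congrArg₂ (· * ·) (congrArg A (hs3 hy)) (bilinField_congr g₁ (hs1 y) (d1 v) (d1 w))
  · exact congrArg₂ (· * ·) (congrArg B (hs3 hy)) (bilinField_congr g₂ (hs2 y) (d2 v) (d2 w))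

end SubProduct

/-! ### Signature of an orthogonal sum -/

section LinearAlgebra

variable {E F : Type*} [AddCommGroup E] [Module ℝ E] [AddCommGroup F] [Module ℝ F]

theorem isCompl_submodule_prod {p p' : Submodule ℝ E} {q q' : Submodule ℝ F} (h : IsCompl p p')
    (h' : IsCompl q q') : IsCompl (p.prod q) (p'.prod q') :=
  IsCompl.of_eq (by rw [Submodule.prod_inf_prod, h.inf_eq_bot, h'.inf_eq_bot, Submodule.prod_bot])
    (by rw [Submodule.prod_sup_prod, h.sup_eq_top, h'.sup_eq_top, Submodule.prod_top])

theorem finrank_submodule_prod [FiniteDimensional ℝ E] [FiniteDimensional ℝ F]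
    (p : Submodule ℝ E) (q : Submodule ℝ F) :
    Module.finrank ℝ (p.prod q) = Module.finrank ℝ p + Module.finrank ℝ q := by
  have h : LinearMap.range (LinearMap.prodMap p.subtype q.subtype) = p.prod q := by
    rw [LinearMap.range_prodMap, Submodule.range_subtype, Submodule.range_subtype]
  rw [← h, LinearMap.finrank_range_of_inj, Module.finrank_prod]
  exact Function.Injective.prodMap p.injective_subtype q.injective_subtype

/-- `b` has signature `(p, q)`. -/
def HasSignature (b : E → E → ℝ) (p q : ℕ) : Prop :=
  ∃ P N : Submodule ℝ E, IsCompl P N ∧ Module.finrank ℝ P = p ∧ Module.finrank ℝ N = q ∧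
    (∀ v ∈ P, v ≠ 0 → 0 < b v v) ∧ (∀ v ∈ N, v ≠ 0 → b v v < 0)

/-- The radial line is positive and joins `P₁` and `P₂`, which explains the extra 1. Vanishing at 0
is assumed because the forms are here mere functions of two variables. -/
theorem HasSignature.warped [FiniteDimensional ℝ E] [FiniteDimensional ℝ F]
    {b₁ : E → E → ℝ} {b₂ : F → F → ℝ} {p₁ q₁ p₂ q₂ : ℕ} (h₁ : HasSignature b₁ p₁ q₁)
    (h₂ : HasSignature b₂ p₂ q₂) (hb₁ : b₁ 0 0 = 0) (hb₂ : b₂ 0 0 = 0) {c a b : ℝ} (hc : 0 < c)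
    (ha : 0 < a) (hb : 0 < b) :
    HasSignature (fun v w : E × F × EuclideanSpace ℝ (Fin 1) =>
      c * (v.2.2 0 * w.2.2 0) + a * b₁ v.1 w.1 + b * b₂ v.2.1 w.2.1)
      (p₁ + p₂ + 1) (q₁ + q₂) := by
  obtain ⟨P₁, N₁, hc₁, hp₁, hq₁, hP₁, hN₁⟩ := h₁
  obtain ⟨P₂, N₂, hc₂, hp₂, hq₂, hP₂, hN₂⟩ := h₂
  have nonneg₁ (v) (hv : v ∈ P₁) : 0 ≤ b₁ v v := by
    rcases eq_or_ne v 0 with rfl | h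
    exacts [hb₁.ge, (hP₁ v hv h).le]
  have nonneg₂ (v) (hv : v ∈ P₂) : 0 ≤ b₂ v v := by
    rcases eq_or_ne v 0 with rfl | h
    exacts [hb₂.ge, (hP₂ v hv h).le]
  have nonpos₁ (v) (hv : v ∈ N₁) : b₁ v v ≤ 0 := by
    rcases eq_or_ne v 0 with rfl | h
    exacts [hb₁.le, (hN₁ v hv h).le]
  have nonpos₂ (v) (hv : v ∈ N₂) : b₂ v v ≤ 0 := by
    rcases eq_or_ne v 0 with rfl | h
    exacts [hb₂.le, (hN₂ v hv h).le]
  refine ⟨P₁.prod (P₂.prod ⊤), N₁.prod (N₂.prod ⊥),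
    isCompl_submodule_prod hc₁ (isCompl_submodule_prod hc₂ isCompl_top_bot), ?_, ?_, ?_, ?_⟩
  · rw [finrank_submodule_prod, finrank_submodule_prod, finrank_top, finrank_euclideanSpace_fin,
      hp₁, hp₂, add_assoc]
  · rw [finrank_submodule_prod, finrank_submodule_prod, finrank_bot, hq₁, hq₂, add_zero]
  · rintro ⟨v₁, v₂, v₃⟩ ⟨h1, h2, -⟩ hv
    have e1 := mul_nonneg ha.le (nonneg₁ v₁ h1)
    have e2 := mul_nonneg hb.le (nonneg₂ v₂ h2)
    have e3 := mul_nonneg hc.le (mul_self_nonneg (v₃ 0))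
    by_contra hle
    simp only [not_lt] at hle
    refine hv ?_
    have z1 : v₁ = 0 := by
      by_contra h
      linarith [mul_pos ha (hP₁ v₁ h1 h)]
    have z2 : v₂ = 0 := by
      by_contra h
      linarith [mul_pos hb (hP₂ v₂ h2 h)]
    have z3 : v₃ = 0 := by
      ext i
      fin_cases i
      by_contra h
      linarith [mul_pos hc (mul_self_pos.2 (show v₃ 0 ≠ 0 from h))]
    rw [z1, z2, z3]
    rfl
  · rintro ⟨v₁, v₂, v₃⟩ ⟨h1, h2, h3⟩ hv
    obtain rfl : v₃ = 0 := h3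
    have e1 := mul_nonneg ha.le (neg_nonneg.2 (nonpos₁ v₁ h1))
    have e2 := mul_nonneg hb.le (neg_nonneg.2 (nonpos₂ v₂ h2))
    by_contra hle
    simp only [not_lt, PiLp.zero_apply, mul_zero, zero_add] at hle
    refine hv ?_
    have z1 : v₁ = 0 := by
      by_contra h
      linarith [mul_pos ha (neg_pos.2 (hN₁ v₁ h1 h))]
    have z2 : v₂ = 0 := by
      by_contra h
      linarith [mul_pos hb (neg_pos.2 (hN₂ v₂ h2 h))]
    rw [z1, z2]
    rfl

end LinearAlgebra

/-- The value at `x` of a field of bilinear forms, as a form on the model space, to which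
`TangentSpace I x` is definitionally equal. -/
def fiberForm {E : Type*} [NormedAddCommGroup E] [NormedSpace ℝ E]
    {H : Type*} [TopologicalSpace H] {I : ModelWithCorners ℝ E H}
    {M : Type*} [TopologicalSpace M] [ChartedSpace H M] (g : BilinField I M) (x : M) :
    E →L[ℝ] E →L[ℝ] ℝ := g x

/-! ### Interior, boundary and metric property of the warped field -/

section SubProduct

variable {m₁ m₂ : ℕ} {M₁ M₂ : Type*}
  [TopologicalSpace M₁] [ChartedSpace (EuclideanSpace ℝ (Fin m₁)) M₁]
  [TopologicalSpace M₂] [ChartedSpace (EuclideanSpace ℝ (Fin m₂)) M₂] {μ : ℝ}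

theorem mem_interior_subProduct_iff (z : SubProduct m₂ M₁ M₂ μ) :
    z ∈ (subProductModel m₁ m₂).interior (SubProduct m₂ M₁ M₂ μ) ↔ 0 < radius m₂ μ z := by
  have h : (𝓡∂ 1).IsInteriorPoint z.2.2.1 ↔ 0 < radius m₂ μ z := by
    rw [ModelWithCorners.IsInteriorPoint, interior_range_modelWithCornersEuclideanHalfSpace]
    rfl
  rw [ModelWithCorners.interior_prod, ModelWithCorners.interior_prod,
    ModelWithCorners.interior_open, ModelWithCorners.interior_eq_univ,
    ModelWithCorners.interior_eq_univ, ← h]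
  simp only [mem_prod, mem_univ, true_and]
  rfl

omit [TopologicalSpace M₁] [TopologicalSpace M₂]
  [ChartedSpace (EuclideanSpace ℝ (Fin m₂)) M₂] in
theorem radius_nonneg (z : SubProduct m₂ M₁ M₂ μ) : 0 ≤ radius m₂ μ z := z.2.2.1.2

theorem mem_boundary_subProduct_iff (z : SubProduct m₂ M₁ M₂ μ) :
    z ∈ (subProductModel m₁ m₂).boundary (SubProduct m₂ M₁ M₂ μ) ↔ radius m₂ μ z = 0 := by
  rw [← ModelWithCorners.compl_interior, mem_compl_iff, mem_interior_subProduct_iff, not_lt]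
  exact ⟨fun h => h.antisymm (radius_nonneg z), fun h => h.le⟩

variable [IsManifold (𝓡 m₁) ∞ M₁] [IsManifold (𝓡 m₂) ∞ M₂]

/-- Evaluating the chart expression at the centre of the chart, where tangent spaces are identified
with the model space by the identity, gives a block form. -/
theorem warpedField_eq (C A B : ℝ → ℝ) (g₁ : BilinField (𝓡 m₁) M₁) (g₂ : BilinField (𝓡 m₂) M₂)
    (z : SubProduct m₂ M₁ M₂ μ)
    (v w : EuclideanSpace ℝ (Fin m₁) × EuclideanSpace ℝ (Fin m₂) × EuclideanSpace ℝ (Fin 1)) :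
    warpedField C A B g₁ g₂ μ z v w = C (radius m₂ μ z) * (v.2.2 0 * w.2.2 0)
      + A (radius m₂ μ z) * fiberForm g₁ z.1 v.1 w.1
      + B (radius m₂ μ z) * fiberForm g₂ z.2.1 v.2.1 w.2.1 := by
  refine (inChart_self (I := subProductModel m₁ m₂) (warpedField C A B g₁ g₂ μ) z v w).symm.trans ?_
  rw [inChart_warpedField C A B g₁ g₂ z (mem_extChartAt_target z), warped_apply]
  exact congrArg₂ (· + ·) (congrArg₂ (· + ·) rfl
    (congrArg₂ (· * ·) rfl (inChart_self g₁ z.1 v.1 w.1)))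
    (congrArg₂ (· * ·) rfl (inChart_self g₂ z.2.1 v.2.1 w.2.1))

theorem isMetricOn_warpedField {C A B : ℝ → ℝ} {g₁ : BilinField (𝓡 m₁) M₁}
    {g₂ : BilinField (𝓡 m₂) M₂} {p₁ q₁ p₂ q₂ : ℕ} (hg₁ : IsMetricOn (𝓡 m₁) univ p₁ q₁ g₁)
    (hg₂ : IsMetricOn (𝓡 m₂) univ p₂ q₂ g₂) {U : Set (SubProduct m₂ M₁ M₂ μ)}
    (hC : ∀ z ∈ U, 0 < C (radius m₂ μ z)) (hA : ∀ z ∈ U, 0 < A (radius m₂ μ z))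
    (hB : ∀ z ∈ U, 0 < B (radius m₂ μ z)) (hC' : ∀ z ∈ U, ContDiffAt ℝ ∞ C (radius m₂ μ z))
    (hA' : ∀ z ∈ U, ContDiffAt ℝ ∞ A (radius m₂ μ z))
    (hB' : ∀ z ∈ U, ContDiffAt ℝ ∞ B (radius m₂ μ z)) :
    IsMetricOn (subProductModel m₁ m₂) U (p₁ + p₂ + 1) (q₁ + q₂)
      (warpedField C A B g₁ g₂ μ) where
  smooth z hz := by
    refine ContMDiffAt.contMDiffWithinAt ((contMDiffAt_bilinField_iff _ z).2 ?_)
    refine (contDiffWithinAt_warped (hC' z hz) (hA' z hz) (hB' z hz)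
      (hg₁.contDiffAt_inChart z.1) (hg₂.contDiffAt_inChart z.2.1)).congr_of_eventuallyEq ?_
      (inChart_warpedField C A B g₁ g₂ z (mem_extChartAt_target z))
    filter_upwards [extChartAt_target_mem_nhdsWithin z] with y hy
      using inChart_warpedField C A B g₁ g₂ z hy
  symm z hz v w := by
    refine (warpedField_eq C A B g₁ g₂ z v w).trans
      (Eq.trans ?_ (warpedField_eq C A B g₁ g₂ z w v).symm)
    have h1 := hg₁.symm z.1 (mem_univ _) v.1 w.1
    have h2 := hg₂.symm z.2.1 (mem_univ _) v.2.1 w.2.1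
    exact congrArg₂ (· + ·) (congrArg₂ (· + ·)
      (congrArg₂ (· * ·) rfl (mul_comm (v.2.2 0) (w.2.2 0))) (congrArg₂ (· * ·) rfl h1))
      (congrArg₂ (· * ·) rfl h2)
  nondegenerate z hz v hv := by
    refine warped_nondegenerate (C := C) (A := A) (B := B) (G₁ := fun _ => fiberForm g₁ z.1)
      (G₂ := fun _ => fiberForm g₂ z.2.1) (y := extChartAt (subProductModel m₁ m₂) z z)
      (hC z hz).ne' (hA z hz).ne' (hB z hz).ne' (hg₁.nondegenerate z.1 (mem_univ _))
      (hg₂.nondegenerate z.2.1 (mem_univ _)) v fun w => ?_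
    exact (warped_apply _ _ _).trans ((warpedField_eq C A B g₁ g₂ z v w).symm.trans (hv w))
  signature z hz := by
    have h1 : HasSignature (fun v w => fiberForm g₁ z.1 v w) p₁ q₁ := hg₁.signature z.1 (mem_univ _)
    have h2 : HasSignature (fun v w => fiberForm g₂ z.2.1 v w) p₂ q₂ := hg₂.signature z.2.1 (mem_univ _)
    obtain ⟨P, N, h, hp, hq, hP, hN⟩ := HasSignature.warped h1 h2 (by simp) (by simp) (hC z hz)
      (hA z hz) (hB z hz)
    exact ⟨P, N, h, hp, hq, fun v hv hv0 => (hP v hv hv0).trans_eq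
      (warpedField_eq C A B g₁ g₂ z v v).symm, fun v hv hv0 =>
      (warpedField_eq C A B g₁ g₂ z v v).trans_lt (hN v hv hv0)⟩

/-- The tangent spaces of `M₂` are zero, so the coefficient of `g₂` never matters. -/
theorem warpedField_congr_of_eq_zero {C A B B' : ℝ → ℝ} (hm : m₂ = 0)
    (g₁ : BilinField (𝓡 m₁) M₁) (g₂ : BilinField (𝓡 m₂) M₂) :
    warpedField C A B g₁ g₂ μ = warpedField C A B' g₁ g₂ μ := by
  subst hm
  funext z
  refine ContinuousLinearMap.ext fun v => ContinuousLinearMap.ext fun w => ?_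
  refine (warpedField_eq C A B g₁ g₂ z v w).trans
    (Eq.trans ?_ (warpedField_eq C A B' g₁ g₂ z v w).symm)
  have h : (v : EuclideanSpace ℝ (Fin m₁) × EuclideanSpace ℝ (Fin 0) ×
    EuclideanSpace ℝ (Fin 1)).2.1 = 0 := Subsingleton.elim _ _
  rw [h]
  simp

end SubProduct

/-! ### The radial coefficients and their zeros -/

section Radial

/-- The coefficient `r⁻² (1 - μ r² / 2)²`. -/
def profile (μ r : ℝ) : ℝ := (r ^ 2)⁻¹ * (1 - μ * r ^ 2 / 2) ^ 2

theorem contDiffAt_profile {n : ℕ∞ω} (μ : ℝ) {r : ℝ} (hr : r ≠ 0) :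
    ContDiffAt ℝ n (profile μ) r := by
  unfold profile
  have h : r ^ 2 ≠ 0 := pow_ne_zero 2 hr
  fun_prop (disch := assumption)

theorem isLogDerivAt_inv_sq {r : ℝ} (hr : r ≠ 0) :
    IsLogDerivAt (fun s => (s ^ 2)⁻¹) (fun s => -s⁻¹) ((r ^ 2)⁻¹) r where
  contDiffAt := by
    have h : r ^ 2 ≠ 0 := pow_ne_zero 2 hr
    fun_prop (disch := assumption)
  ne_zero := by
    filter_upwards [isOpen_ne.mem_nhds hr] with s hs using inv_ne_zero (pow_ne_zero 2 hs)
  hasDerivAt := by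
    filter_upwards [isOpen_ne.mem_nhds hr] with s hs
    have hs : s ≠ 0 := hs
    refine ((hasDerivAt_pow 2 s).inv (pow_ne_zero 2 hs)).congr_deriv ?_
    field_simp
    norm_num
    ring
  hasDerivAt_log := by
    refine ((hasDerivAt_inv hr).neg).congr_deriv ?_
    ring

/-- Here α = -1/r - μr/(1 - μr²/2). The derivative is stated as the Riccati equation α' = αγ - α² +
r⁻² with γ = -1/r, the form in which the dr² part of Ricci collapses to -r⁻² for each dimension. -/
theorem isLogDerivAt_profile {μ r : ℝ} (hr : r ≠ 0) (hμ : 1 - μ * r ^ 2 / 2 ≠ 0) :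
    IsLogDerivAt (profile μ) (fun s => -((1 + μ * s ^ 2 / 2) / (s * (1 - μ * s ^ 2 / 2))))
      ((1 + μ * r ^ 2 / 2) / (r * (1 - μ * r ^ 2 / 2)) * r⁻¹
        - ((1 + μ * r ^ 2 / 2) / (r * (1 - μ * r ^ 2 / 2))) ^ 2 + (r ^ 2)⁻¹) r where
  contDiffAt := contDiffAt_profile μ hr
  ne_zero := by
    have hc : ContinuousAt (fun s : ℝ => 1 - μ * s ^ 2 / 2) r := by fun_prop
    filter_upwards [isOpen_ne.mem_nhds hr, hc.eventually_ne hμ] with s hs hs'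
    exact mul_ne_zero (inv_ne_zero (pow_ne_zero 2 hs)) (pow_ne_zero 2 hs')
  hasDerivAt := by
    have hc : ContinuousAt (fun s : ℝ => 1 - μ * s ^ 2 / 2) r := by fun_prop
    filter_upwards [isOpen_ne.mem_nhds hr, hc.eventually_ne hμ] with s hs hs'
    have hs : s ≠ 0 := hs
    have h1 := (((hasDerivAt_pow 2 s).const_mul μ).div_const 2).const_sub 1
    refine (((hasDerivAt_pow 2 s).inv (pow_ne_zero 2 hs)).mul (h1.pow 2)).congr_deriv ?_
    simp only [profile, Pi.pow_apply, Pi.inv_apply]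
    field_simp
    norm_num
    ring
  hasDerivAt_log := by
    have h1 := (((hasDerivAt_pow 2 r).const_mul μ).div_const 2).const_sub 1
    have h2 := (((hasDerivAt_pow 2 r).const_mul μ).div_const 2).const_add 1
    refine ((h2.div ((hasDerivAt_id r).mul h1) (mul_ne_zero hr hμ)).neg).congr_deriv ?_
    have hμ' : 2 - μ * r ^ 2 ≠ 0 := fun h => hμ (by linarith)
    simp only [Pi.mul_apply, id]
    field_simp
    norm_num
    ring

theorem ne_zero_of_mem_radialSet {μ t : ℝ} {m₂ : ℕ} (ht : t ∈ radialSet μ m₂) :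
    1 - μ * t ^ 2 / 2 ≠ 0 ∧ (m₂ ≠ 0 → 1 + μ * t ^ 2 / 2 ≠ 0) := by
  have key {ν : ℝ} (hν : 0 < ν) (h0 : 0 ≤ t) (h : ν * t ^ 2 = 2) : t = √(2 / ν) := by
    rw [eq_comm, Real.sqrt_eq_iff_eq_sq (by positivity) h0, div_eq_iff hν.ne']
    linarith
  unfold radialSet at ht
  refine ⟨fun h => ?_, fun hm h => ?_⟩
  · have hμ : 0 < μ := by
      by_contra hle
      nlinarith [mul_nonneg (neg_nonneg.2 (not_lt.1 hle)) (sq_nonneg t)]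
    rw [if_neg hμ.ne', if_neg (fun h => h.1.not_gt hμ)] at ht
    split_ifs at ht with h'
    · exact ht.2 (key hμ ht.1 (by linarith))
    · rw [abs_of_pos hμ] at ht
      exact ht.2 (key hμ ht.1 (by linarith))
  · have hμ : 0 < -μ := by
      by_contra hle
      nlinarith [mul_nonneg (neg_nonneg.2 (not_lt.1 hle)) (sq_nonneg t)]
    rw [if_neg (neg_pos.1 hμ).ne, if_neg (fun h => hm h.2), if_neg (fun h => hm h.2),
      abs_of_neg (neg_pos.1 hμ)] at ht
    exact ht.2 (key hμ ht.1 (by linarith))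

end Radial

/-! ### Einstein constants, scalar curvature and the choice of μ -/

section Einstein

variable {m : ℕ} {M : Type*} [TopologicalSpace M] [ChartedSpace (EuclideanSpace ℝ (Fin m)) M]
  [IsManifold (𝓡 m) ∞ M] {g : BilinField (𝓡 m) M} {p q : ℕ}

theorem scalarCurvature_of_isEinsteinOn (hg : IsMetricOn (𝓡 m) univ p q g) {c : ℝ}
    (hE : IsEinsteinOn (𝓡 m) univ c g) (x : M) : scalarCurvature (𝓡 m) g x = c * m := by
  have h := scalarCoord_of_einstein (hg.isRegularAt_inChart x).nondegenerate.self_of_nhds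
    (s := range (𝓡 m)) (c := c) fun v w =>
      (hE x (mem_univ x) v w).trans (congrArg (c * ·) (inChart_self g x v w).symm)
  rwa [finrank_euclideanSpace_fin] at h

theorem scalarCurvature_eq_zero_of_le_one (hg : IsMetricOn (𝓡 m) univ p q g) (hm : m ≤ 1) (x : M) :
    scalarCurvature (𝓡 m) g x = 0 := by
  have h := scalarCoord_of_einstein (hg.isRegularAt_inChart x).nondegenerate.self_of_nhds
    (s := range (𝓡 m)) (c := 0) fun v w => by
      rw [ricciCoord_eq_zero_of_finrank_le_one (by simpa using hm), zero_mul]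
  rwa [zero_mul] at h

theorem exists_scalarCurvature_eq (hg : IsMetricOn (𝓡 m) univ p q g)
    (hE : ∃ c, IsEinsteinOn (𝓡 m) univ c g) :
    ∃ κ : ℝ, ∀ x, scalarCurvature (𝓡 m) g x = 2 * (m : ℝ) * ((m : ℝ) - 1) * κ := by
  obtain ⟨c, hc⟩ := hE
  rcases le_or_gt m 1 with hm | hm
  · refine ⟨0, fun x => ?_⟩
    rw [scalarCurvature_eq_zero_of_le_one hg hm, mul_zero]
  · refine ⟨c / (2 * ((m : ℝ) - 1)), fun x => ?_⟩
    have : (m : ℝ) - 1 ≠ 0 := sub_ne_zero.2 (by exact_mod_cast hm.ne')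
    rw [scalarCurvature_of_isEinsteinOn hg hc]
    field_simp

/-- For m ≥ 2 the scalar curvature cm determines c. For m ≤ 1 Ricci vanishes, and so does the
right-hand side: through the factor m - 1 if m = 1, through v = 0 if m = 0, where c is arbitrary. -/
theorem ricciCoord_inChart_eq (hg : IsMetricOn (𝓡 m) univ p q g)
    (hE : ∃ c, IsEinsteinOn (𝓡 m) univ c g) {κ : ℝ} {x : M}
    (hκ : 2 * (m : ℝ) * ((m : ℝ) - 1) * κ = scalarCurvature (𝓡 m) g x)
    (v w : EuclideanSpace ℝ (Fin m)) :
    ricciCoord (inChart (𝓡 m) g x) univ (extChartAt (𝓡 m) x x) v w =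
      2 * ((m : ℝ) - 1) * κ * inChart (𝓡 m) g x (extChartAt (𝓡 m) x x) v w := by
  obtain ⟨c, hc⟩ := hE
  rcases le_or_gt m 1 with hm | hm
  · rw [ricciCoord_eq_zero_of_finrank_le_one (by simpa using hm)]
    interval_cases m
    · rw [Subsingleton.elim v 0, map_zero, zero_apply, mul_zero]
    · simp
  · have h := (hc x (mem_univ x) v w).trans (congrArg (c * ·) (inChart_self g x v w).symm)
    have h' : ricciCoord (inChart (𝓡 m) g x) (range (𝓡 m)) (extChartAt (𝓡 m) x x) v w =
      c * inChart (𝓡 m) g x (extChartAt (𝓡 m) x x) v w := h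
    rw [(𝓡 m).range_eq_univ] at h'
    rw [h']
    congr 1
    rw [scalarCurvature_of_isEinsteinOn hg hc] at hκ
    have hm0 : (m : ℝ) ≠ 0 := by exact_mod_cast (by omega : m ≠ 0)
    refine mul_right_cancel₀ hm0 ?_
    linarith

end Einstein

section Admissible

theorem exists_isAdmissible {m₁ m₂ : ℕ} {M₁ M₂ : Type*} {S₁ : M₁ → ℝ} {S₂ : M₂ → ℝ}
    (hm₁ : 1 ≤ m₁) {κ₁ κ₂ : ℝ} (h₁ : ∀ x, S₁ x = 2 * (m₁ : ℝ) * ((m₁ : ℝ) - 1) * κ₁)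
    (h₂ : ∀ y, S₂ y = 2 * (m₂ : ℝ) * ((m₂ : ℝ) - 1) * κ₂)
    (h : ∀ x y, (m₂ : ℝ) * ((m₂ : ℝ) - 1) * S₁ x = -((m₁ : ℝ) * ((m₁ : ℝ) - 1) * S₂ y)) :
    ∃ μ, IsAdmissible m₁ m₂ S₁ S₂ μ := by
  by_cases hM : 1 < m₁ ∧ Nonempty M₁
  · obtain ⟨hm, ⟨x⟩⟩ := hM
    refine ⟨κ₁, fun x => (h₁ x).symm, fun y => ?_⟩
    have e := h x y
    rw [h₁ x] at e
    have h0 : (m₁ : ℝ) * ((m₁ : ℝ) - 1) ≠ 0 :=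
      mul_ne_zero (by exact_mod_cast (by omega : m₁ ≠ 0))
        (sub_ne_zero.2 (by exact_mod_cast hm.ne'))
    refine mul_left_cancel₀ h0 ?_
    linarith
  -- Now the first equation is void: either `M₁` is empty, or `m₁` is 1 and both sides are zero. The
  -- second equation alone fixes the choice.
  · refine ⟨-κ₂, fun x => ?_, fun y => by rw [h₂ y]; ring⟩
    have hm : m₁ = 1 := by
      by_contra h1
      exact hM ⟨by omega, ⟨x⟩⟩
    rw [h₁ x, hm]
    simp

end Admissible

/-! ### The boundary inclusion and the induced metric -/

section SubProduct

variable {m₁ m₂ : ℕ} {M₁ M₂ : Type*}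
  [TopologicalSpace M₁] [ChartedSpace (EuclideanSpace ℝ (Fin m₁)) M₁]
  [TopologicalSpace M₂] [ChartedSpace (EuclideanSpace ℝ (Fin m₂)) M₂] {μ : ℝ}

theorem contMDiff_boundaryInclusion : ContMDiff ((𝓡 m₁).prod (𝓡 m₂)) (subProductModel m₁ m₂) ∞
    (boundaryInclusion (M₁ := M₁) (M₂ := M₂) m₂ μ) :=
  contMDiff_fst.prodMk (contMDiff_snd.prodMk contMDiff_const)

theorem range_boundaryInclusion : range (boundaryInclusion (M₁ := M₁) (M₂ := M₂) m₂ μ) =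
    (subProductModel m₁ m₂).boundary (SubProduct m₂ M₁ M₂ μ) := by
  ext z
  rw [mem_boundary_subProduct_iff (m₁ := m₁)]
  constructor
  · rintro ⟨b, rfl⟩
    rfl
  · intro h
    refine ⟨(z.1, z.2.1), Prod.ext rfl (Prod.ext rfl (Subtype.ext (Subtype.ext ?_)))⟩
    ext i
    fin_cases i
    exact h.symm

theorem warpedField_eq_subProductMetric (g₁ : BilinField (𝓡 m₁) M₁) (g₂ : BilinField (𝓡 m₂) M₂) :
    subProductMetric m₁ m₂ g₁ g₂ μ =
      warpedField (fun r => (r ^ 2)⁻¹) (profile μ) (profile (-μ)) g₁ g₂ μ := by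
  funext z
  refine ContinuousLinearMap.ext fun v => ContinuousLinearMap.ext fun w => ?_
  have h (a d b x b' y : ℝ) : a * (d + b * x + b' * y) = a * d + a * b * x + a * b' * y := by ring
  refine Eq.trans ?_ (warpedField_apply _ _ _ g₁ g₂ z v w).symm
  simp only [profile, neg_mul, neg_div, sub_neg_eq_add]
  exact h _ _ _ _ _ _

/-- Along the boundary `radius` is constant, so dr pulls back to zero, whatever the value of `C` at
0; the projections restrict to those of M₁ × M₂. -/
theorem pullback_boundaryInclusion (g₁ : BilinField (𝓡 m₁) M₁) (g₂ : BilinField (𝓡 m₂) M₂)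
    {C A B : ℝ → ℝ} (hA : A 0 = 1) (hB : B 0 = 1) :
    pullback ((𝓡 m₁).prod (𝓡 m₂)) (subProductModel m₁ m₂) (boundaryInclusion m₂ μ)
      (warpedField C A B g₁ g₂ μ) = productMetric m₁ m₂ g₁ g₂ := by
  funext b
  refine ContinuousLinearMap.ext fun v => ContinuousLinearMap.ext fun w => ?_
  have hι : MDifferentiableAt ((𝓡 m₁).prod (𝓡 m₂)) (subProductModel m₁ m₂)
      (boundaryInclusion (M₁ := M₁) (M₂ := M₂) m₂ μ) b :=
    contMDiff_boundaryInclusion.mdifferentiableAt (by simp)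
  set ι := boundaryInclusion (M₁ := M₁) (M₂ := M₂) m₂ μ with hιdef
  have h1 : mfderiv ((𝓡 m₁).prod (𝓡 m₂)) (𝓡 m₁) Prod.fst b =
      (mfderiv (subProductModel m₁ m₂) (𝓡 m₁) (fun z : SubProduct m₂ M₁ M₂ μ => z.1) (ι b)).comp
        (mfderiv ((𝓡 m₁).prod (𝓡 m₂)) (subProductModel m₁ m₂) ι b) :=
    mfderiv_comp b mdifferentiableAt_fst hι
  have h2 : mfderiv ((𝓡 m₁).prod (𝓡 m₂)) (𝓡 m₂) Prod.snd b =
      (mfderiv (subProductModel m₁ m₂) (𝓡 m₂) (fun z : SubProduct m₂ M₁ M₂ μ => z.2.1) (ι b)).comp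
        (mfderiv ((𝓡 m₁).prod (𝓡 m₂)) (subProductModel m₁ m₂) ι b) :=
    mfderiv_comp b ((contMDiff_fst (n := ∞)).comp contMDiff_snd |>.mdifferentiableAt (by simp)) hι
  have h3 : (0 : TangentSpace ((𝓡 m₁).prod (𝓡 m₂)) b →L[ℝ] ℝ) =
      (mfderiv (subProductModel m₁ m₂) 𝓘(ℝ, ℝ) (radius m₂ μ) (ι b)).comp
        (mfderiv ((𝓡 m₁).prod (𝓡 m₂)) (subProductModel m₁ m₂) ι b) :=
    Eq.trans (mfderiv_const (c := (0 : ℝ))).symm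
      (mfderiv_comp b (contMDiff_radius.mdifferentiableAt (by simp)) hι)
  have h0 : radius m₂ μ (ι b) = 0 := rfl
  have e (c d x y : ℝ) : c * (0 * d) + 1 * x + 1 * y = x + y := by ring
  refine (warpedField_apply C A B g₁ g₂ (ι b) _ _).trans ?_
  refine Eq.trans ?_ (e (C 0) 0 _ _)
  refine congrArg₂ (· + ·) (congrArg₂ (· + ·) (congrArg₂ (· * ·) rfl (congrArg₂ (· * ·)
    (DFunLike.congr_fun h3 v).symm (DFunLike.congr_fun h3 w).symm)) (congrArg₂ (· * ·) hA ?_))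
    (congrArg₂ (· * ·) hB ?_)
  · exact bilinField_congr g₁ rfl (DFunLike.congr_fun h1 v).symm (DFunLike.congr_fun h1 w).symm
  · exact bilinField_congr g₂ rfl (DFunLike.congr_fun h2 v).symm (DFunLike.congr_fun h2 w).symm

variable [IsManifold (𝓡 m₁) ∞ M₁] [IsManifold (𝓡 m₂) ∞ M₂]

/-- In product charts the inclusion is u ↦ (u, 0) up to reassociating the product, with a line as
complement; forgetting r is a continuous left inverse. -/
theorem isSmoothEmbedding_boundaryInclusion :
    Manifold.IsSmoothEmbedding ((𝓡 m₁).prod (𝓡 m₂)) (subProductModel m₁ m₂) ∞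
      (boundaryInclusion (M₁ := M₁) (M₂ := M₂) m₂ μ) := by
  have hc : Continuous (boundaryInclusion (M₁ := M₁) (M₂ := M₂) m₂ μ) :=
    (contMDiff_boundaryInclusion (m₁ := m₁) (m₂ := m₂)).continuous
  refine ⟨⟨EuclideanSpace ℝ (Fin 1), inferInstance, inferInstance, fun b => ?_⟩,
    Function.LeftInverse.isEmbedding (f := fun z : SubProduct m₂ M₁ M₂ μ => (z.1, z.2.1))
      (fun _ => rfl) (by fun_prop) hc⟩
  refine Manifold.IsImmersionAtOfComplement.mk_of_continuousAt hc.continuousAt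
    (ContinuousLinearEquiv.prodAssoc ℝ _ _ _)
    (chartAt _ b) (chartAt _ (boundaryInclusion m₂ μ b)) (mem_chart_source _ _)
    (mem_chart_source _ _) (IsManifold.chart_mem_maximalAtlas _)
    (IsManifold.chart_mem_maximalAtlas _) ?_
  change EqOn (extChartAt (subProductModel m₁ m₂) (boundaryInclusion m₂ μ b) ∘
    boundaryInclusion m₂ μ ∘ (extChartAt ((𝓡 m₁).prod (𝓡 m₂)) b).symm) _
    (extChartAt ((𝓡 m₁).prod (𝓡 m₂)) b).target
  intro u hu
  have h := (extChartAt ((𝓡 m₁).prod (𝓡 m₂)) b).right_inv hu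
  have h1 := congrArg Prod.fst h
  have h2 := congrArg Prod.snd h
  refine Prod.ext ?_ (Prod.ext ?_ ?_)
  · exact h1
  · exact h2
  · rfl

end SubProduct

/-- With x = μr²/2 this is (1 + x)² - (1 - x)² = 4x divided by r²; in the variable log r it reads
a'² = a² + 2μ. -/
theorem sq_mul_profile {μ r : ℝ} (hr : r ≠ 0) (hd : 1 - μ * r ^ 2 / 2 ≠ 0) :
    ((1 + μ * r ^ 2 / 2) / (r * (1 - μ * r ^ 2 / 2))) ^ 2 * profile μ r * r ^ 2 =
      profile μ r + 2 * μ := by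
  unfold profile
  generalize h : 1 - μ * r ^ 2 / 2 = d at hd
  rw [show 1 + μ * r ^ 2 / 2 = 2 - d by linarith, show μ = (2 - 2 * d) / r ^ 2 by
    rw [← h]; field_simp; ring]
  field_simp
  ring

/-! ### The Einstein equation -/

section SubProduct

variable {m₁ m₂ : ℕ} {M₁ M₂ : Type*}
  [TopologicalSpace M₁] [ChartedSpace (EuclideanSpace ℝ (Fin m₁)) M₁]
  [TopologicalSpace M₂] [ChartedSpace (EuclideanSpace ℝ (Fin m₂)) M₂] {μ : ℝ}

/-- The field dr² is the warped field with coefficients 1, 0, 0, and its block form gives 1 on the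
radial unit vector. -/
theorem mfderiv_radius_ne_zero (z : SubProduct m₂ M₁ M₂ μ) [IsManifold (𝓡 m₁) ∞ M₁]
    [IsManifold (𝓡 m₂) ∞ M₂] :
    mfderiv (subProductModel m₁ m₂) 𝓘(ℝ, ℝ) (radius m₂ μ) z ≠ 0 := by
  intro h
  have hdr (x y : ℝ) : (0 : ℝ) = 1 * (0 * 0) + 0 * x + 0 * y := by ring
  let v : EuclideanSpace ℝ (Fin m₁) × EuclideanSpace ℝ (Fin m₂) × EuclideanSpace ℝ (Fin 1) :=
    (0, 0, EuclideanSpace.single 0 1)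
  have h1 := warpedField_eq (fun _ => 1) (fun _ => 0) (fun _ => 0)
    (0 : BilinField (𝓡 m₁) M₁) (0 : BilinField (𝓡 m₂) M₂) z v v
  have h2 : warpedField (fun _ => 1) (fun _ => 0) (fun _ => 0)
    (0 : BilinField (𝓡 m₁) M₁) (0 : BilinField (𝓡 m₂) M₂) μ z v v = 0 := by
    refine (warpedField_apply _ _ _ _ _ z v v).trans ?_
    refine Eq.trans ?_ (hdr 0 0).symm
    have h3 := DFunLike.congr_fun h v
    exact congrArg₂ (· + ·) (congrArg₂ (· + ·) (congrArg₂ (· * ·) rfl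
      (congrArg₂ (· * ·) h3 h3)) ((zero_mul _).trans (zero_mul _).symm))
      ((zero_mul _).trans (zero_mul _).symm)
  rw [h2] at h1
  simp [v] at h1

variable [IsManifold (𝓡 m₁) ∞ M₁] [IsManifold (𝓡 m₂) ∞ M₂]
  {g₁ : BilinField (𝓡 m₁) M₁} {g₂ : BilinField (𝓡 m₂) M₂} {p₁ q₁ p₂ q₂ : ℕ}

theorem ricci_warpedField (hg₁ : IsMetricOn (𝓡 m₁) univ p₁ q₁ g₁)
    (hg₂ : IsMetricOn (𝓡 m₂) univ p₂ q₂ g₂) {C A B α β γ : ℝ → ℝ} {α' β' γ' : ℝ}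
    {z : SubProduct m₂ M₁ M₂ μ} (hz : 0 < radius m₂ μ z)
    (hC : IsLogDerivAt C γ γ' (radius m₂ μ z)) (hA : IsLogDerivAt A α α' (radius m₂ μ z))
    (hB : IsLogDerivAt B β β' (radius m₂ μ z))
    (v w : EuclideanSpace ℝ (Fin m₁) × EuclideanSpace ℝ (Fin m₂) × EuclideanSpace ℝ (Fin 1)) :
    let r := radius m₂ μ z
    ricci (subProductModel m₁ m₂) (warpedField C A B g₁ g₂ μ) z v w =
      ricciCoord (inChart (𝓡 m₁) g₁ z.1) univ (extChartAt (𝓡 m₁) z.1 z.1) v.1 w.1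
      + ricciCoord (inChart (𝓡 m₂) g₂ z.2.1) univ (extChartAt (𝓡 m₂) z.2.1 z.2.1) v.2.1 w.2.1
      + (m₁ * (α r * γ r - α' - α r ^ 2) + m₂ * (β r * γ r - β' - β r ^ 2)) * (v.2.2 0 * w.2.2 0)
      + (α r * γ r - α' - m₁ * α r ^ 2 - m₂ * α r * β r) * A r / C r
        * inChart (𝓡 m₁) g₁ z.1 (extChartAt (𝓡 m₁) z.1 z.1) v.1 w.1
      + (β r * γ r - β' - m₂ * β r ^ 2 - m₁ * α r * β r) * B r / C r
        * inChart (𝓡 m₂) g₂ z.2.1 (extChartAt (𝓡 m₂) z.2.1 z.2.1) v.2.1 w.2.1 := by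
  intro r
  set y := extChartAt (subProductModel m₁ m₂) z z with hy
  have hint : (subProductModel m₁ m₂).IsInteriorPoint z := (mem_interior_subProduct_iff z).2 hz
  have hs : range (subProductModel m₁ m₂) ∈ 𝓝 y := range_mem_nhds_isInteriorPoint hint
  have ht : (extChartAt (subProductModel m₁ m₂) z).target ∈ 𝓝 y :=
    mem_interior_iff_mem_nhds.1 (ModelWithCorners.isInteriorPoint_iff.1 hint)
  have hG : inChart (subProductModel m₁ m₂) (warpedField C A B g₁ g₂ μ) z =ᶠ[𝓝 y]
      warped C A B (inChart (𝓡 m₁) g₁ z.1) (inChart (𝓡 m₂) g₂ z.2.1) := by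
    filter_upwards [ht] with u hu using inChart_warpedField C A B g₁ g₂ z hu
  have h := congrArg (fun R => R v w) (ricciCoord_congr hs hG)
  refine h.trans ?_
  refine (ricciCoord_warped (y := y) hC hA hB (hg₁.isRegularAt_inChart z.1)
    (hg₂.isRegularAt_inChart z.2.1) v w).trans ?_
  rw [finrank_euclideanSpace_fin, finrank_euclideanSpace_fin]
  rfl

theorem isEinsteinOn_subProductMetric (hg₁ : IsMetricOn (𝓡 m₁) univ p₁ q₁ g₁)
    (hg₂ : IsMetricOn (𝓡 m₂) univ p₂ q₂ g₂) (hE₁ : ∃ c, IsEinsteinOn (𝓡 m₁) univ c g₁)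
    (hE₂ : ∃ c, IsEinsteinOn (𝓡 m₂) univ c g₂)
    (hμ : IsAdmissible m₁ m₂ (scalarCurvature (𝓡 m₁) g₁) (scalarCurvature (𝓡 m₂) g₂) μ) :
    IsEinsteinOn (subProductModel m₁ m₂)
      ((subProductModel m₁ m₂).interior (SubProduct m₂ M₁ M₂ μ)) (-((m₁ : ℝ) + (m₂ : ℝ)))
      (subProductMetric m₁ m₂ g₁ g₂ μ) := by
  intro z hz
  suffices H : ∀ v w : EuclideanSpace ℝ (Fin m₁) × EuclideanSpace ℝ (Fin m₂) ×
      EuclideanSpace ℝ (Fin 1), ricci (subProductModel m₁ m₂) (subProductMetric m₁ m₂ g₁ g₂ μ) z v w =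
        -((m₁ : ℝ) + (m₂ : ℝ)) * subProductMetric m₁ m₂ g₁ g₂ μ z v w from H
  intro v w
  rw [mem_interior_subProduct_iff] at hz
  have hr : radius m₂ μ z ≠ 0 := hz.ne'
  obtain ⟨hd₁, hd₂⟩ := ne_zero_of_mem_radialSet (show radius m₂ μ z ∈ radialSet μ m₂ from z.2.2.2)
  have hC := isLogDerivAt_inv_sq hr
  have hA := isLogDerivAt_profile hr hd₁
  have e₁ := ricciCoord_inChart_eq hg₁ hE₁ (hμ.1 z.1) v.1 w.1
  -- The second factor plays the role of the first with -μ in place of μ.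
  have e₂ := ricciCoord_inChart_eq hg₂ hE₂ (κ := -μ) (x := z.2.1) (by linarith [hμ.2 z.2.1])
    v.2.1 w.2.1
  have key (B : ℝ → ℝ) : -((m₁ : ℝ) + (m₂ : ℝ)) *
      warpedField (fun r => (r ^ 2)⁻¹) (profile μ) B g₁ g₂ μ z v w = -((m₁ : ℝ) + (m₂ : ℝ)) *
        ((radius m₂ μ z ^ 2)⁻¹ * (v.2.2 0 * w.2.2 0)
        + profile μ (radius m₂ μ z) * inChart (𝓡 m₁) g₁ z.1 (extChartAt (𝓡 m₁) z.1 z.1) v.1 w.1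
        + B (radius m₂ μ z)
          * inChart (𝓡 m₂) g₂ z.2.1 (extChartAt (𝓡 m₂) z.2.1 z.2.1) v.2.1 w.2.1) :=
    congrArg (-((m₁ : ℝ) + (m₂ : ℝ)) * ·)
      (((inChart_self (I := subProductModel m₁ m₂) _ z v w).symm.trans
        (DFunLike.congr_fun (DFunLike.congr_fun
          (inChart_warpedField _ _ B g₁ g₂ z (mem_extChartAt_target z)) v) w)).trans
            (warped_apply _ _ _))
  have hk : (radius m₂ μ z ^ 2)⁻¹ * radius m₂ μ z ^ 2 = 1 := inv_mul_cancel₀ (pow_ne_zero 2 hr)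
  have hP := sq_mul_profile hr hd₁
  rw [warpedField_eq_subProductMetric]
  rcases eq_or_ne m₂ 0 with hm | hm
  · rw [warpedField_congr_of_eq_zero (B' := fun _ => 1) hm]
    -- The true coefficient of `g₂` may vanish here, so the constant 1 with logarithmic derivative 0
    -- takes its place.
    have hB : IsLogDerivAt (fun _ => (1 : ℝ)) (fun _ => 0) 0 (radius m₂ μ z) :=
      { contDiffAt := contDiffAt_const
        ne_zero := by simp
        hasDerivAt := by simpa using .of_forall fun s => hasDerivAt_const s (1 : ℝ)
        hasDerivAt_log := hasDerivAt_const _ _ }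
    refine (ricci_warpedField hg₁ hg₂ hz hC hA hB v w).trans (Eq.trans ?_ (key _).symm)
    have hv : v.2.1 = 0 := by
      ext i
      exact (hm ▸ i : Fin 0).elim0
    have hm' : (m₂ : ℝ) = 0 := by rw [hm, Nat.cast_zero]
    rw [e₁, e₂, hv, map_zero, zero_apply, hm', div_inv_eq_mul, div_inv_eq_mul]
    generalize inChart (𝓡 m₁) g₁ z.1 (extChartAt (𝓡 m₁) z.1 z.1) v.1 w.1 = x
    linear_combination x * (1 - m₁) * hP - profile μ (radius m₂ μ z) * x * hk
  · have hd₂ := hd₂ hm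
    have hd₂' : 1 - -μ * radius m₂ μ z ^ 2 / 2 ≠ 0 := by
      rwa [neg_mul, neg_div, sub_neg_eq_add]
    have hB := isLogDerivAt_profile (μ := -μ) hr hd₂'
    refine (ricci_warpedField hg₁ hg₂ hz hC hA hB v w).trans (Eq.trans ?_ (key _).symm)
    rw [e₁, e₂, div_inv_eq_mul, div_inv_eq_mul]
    have hQ := sq_mul_profile hr hd₂'
    -- This is αβr² = 1: numerator and denominator of α and β are interchanged by μ ↦ -μ. It governs
    -- the interaction of the two factors.
    have hPQ : (1 + μ * radius m₂ μ z ^ 2 / 2) / (radius m₂ μ z * (1 - μ * radius m₂ μ z ^ 2 / 2)) *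
        ((1 + -μ * radius m₂ μ z ^ 2 / 2) / (radius m₂ μ z * (1 - -μ * radius m₂ μ z ^ 2 / 2))) *
        radius m₂ μ z ^ 2 = 1 := by
      rw [show 1 + -μ * radius m₂ μ z ^ 2 / 2 = 1 - μ * radius m₂ μ z ^ 2 / 2 by ring,
        show 1 - -μ * radius m₂ μ z ^ 2 / 2 = 1 + μ * radius m₂ μ z ^ 2 / 2 by ring]
      generalize radius m₂ μ z = r at hr hd₁ hd₂
      generalize 1 - μ * r ^ 2 / 2 = d at hd₁
      generalize 1 + μ * r ^ 2 / 2 = d' at hd₂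
      field_simp
    generalize inChart (𝓡 m₁) g₁ z.1 (extChartAt (𝓡 m₁) z.1 z.1) v.1 w.1 = x
    generalize inChart (𝓡 m₂) g₂ z.2.1 (extChartAt (𝓡 m₂) z.2.1 z.2.1) v.2.1 w.2.1 = y
    set P := (1 + μ * radius m₂ μ z ^ 2 / 2) / (radius m₂ μ z * (1 - μ * radius m₂ μ z ^ 2 / 2))
    set Q := (1 + -μ * radius m₂ μ z ^ 2 / 2) / (radius m₂ μ z * (1 - -μ * radius m₂ μ z ^ 2 / 2))
    -- On the first factor the Riccati equation leaves ((1 - m₁)α² - r⁻² - m₂αβ)Ar². The three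
    -- relations turn it into -(m₁ + m₂)A - 2(m₁ - 1)μ, whose last term cancels Ric(g₁); the second
    -- factor is symmetric.
    linear_combination x * (1 - m₁) * hP + y * (1 - m₂) * hQ
      - (profile μ (radius m₂ μ z) * x + profile (-μ) (radius m₂ μ z) * y) * hk
      - (m₂ * profile μ (radius m₂ μ z) * x + m₁ * profile (-μ) (radius m₂ μ z) * y) * hPQ

end SubProduct

/-! ### Conformal compactness -/

section SubProduct

variable {m₁ m₂ : ℕ} {M₁ M₂ : Type*}
  [TopologicalSpace M₁] [ChartedSpace (EuclideanSpace ℝ (Fin m₁)) M₁]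
  [TopologicalSpace M₂] [ChartedSpace (EuclideanSpace ℝ (Fin m₂)) M₂] {μ : ℝ}
  [IsManifold (𝓡 m₁) ∞ M₁] [IsManifold (𝓡 m₂) ∞ M₂]
  {g₁ : BilinField (𝓡 m₁) M₁} {g₂ : BilinField (𝓡 m₂) M₂} {p₁ q₁ p₂ q₂ : ℕ}

theorem isDefiningFunction_radius : IsDefiningFunction (subProductModel m₁ m₂)
    (radius (M₁ := M₁) (M₂ := M₂) m₂ μ) where
  smooth := contMDiff_radius
  nonneg := radius_nonneg
  zero_iff z := (mem_boundary_subProduct_iff z).symm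
  d_ne_zero z _ := mfderiv_radius_ne_zero z

/-- For `m₂ = 0` the coefficient of `g₂` is irrelevant, and may be replaced by a function without
zeros. -/
theorem exists_subProductMetric_eq (m₁ m₂ : ℕ) (M₁ M₂ : Type*)
    [TopologicalSpace M₁] [ChartedSpace (EuclideanSpace ℝ (Fin m₁)) M₁]
    [TopologicalSpace M₂] [ChartedSpace (EuclideanSpace ℝ (Fin m₂)) M₂]
    [IsManifold (𝓡 m₁) ∞ M₁] [IsManifold (𝓡 m₂) ∞ M₂]
    (g₁ : BilinField (𝓡 m₁) M₁) (g₂ : BilinField (𝓡 m₂) M₂) (μ : ℝ) :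
    ∃ b : ℝ → ℝ, ContDiff ℝ ∞ b ∧ b 0 = 1 ∧ (∀ t ∈ radialSet μ m₂, b t ≠ 0) ∧
      subProductMetric m₁ m₂ g₁ g₂ μ = warpedField (fun r => (r ^ 2)⁻¹)
        (fun r => (r ^ 2)⁻¹ * (1 - μ * r ^ 2 / 2) ^ 2) (fun r => (r ^ 2)⁻¹ * b r ^ 2) g₁ g₂ μ := by
  rw [warpedField_eq_subProductMetric]
  rcases eq_or_ne m₂ 0 with hm | hm
  · exact ⟨fun _ => 1, contDiff_const, rfl, by simp, warpedField_congr_of_eq_zero hm g₁ g₂⟩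
  · refine ⟨fun r => 1 - -μ * r ^ 2 / 2, by fun_prop, by simp, fun t ht => ?_, rfl⟩
    change 1 - -μ * t ^ 2 / 2 ≠ 0
    rw [neg_mul, neg_div, sub_neg_eq_add]
    exact (ne_zero_of_mem_radialSet ht).2 hm

theorem hasConformalInfinity_subProductMetric (hg₁ : IsMetricOn (𝓡 m₁) univ p₁ q₁ g₁)
    (hg₂ : IsMetricOn (𝓡 m₂) univ p₂ q₂ g₂) (μ : ℝ) :
    HasConformalInfinity (subProductModel m₁ m₂) (p₁ + p₂ + 1) (q₁ + q₂)
      (subProductMetric m₁ m₂ g₁ g₂ μ) ((𝓡 m₁).prod (𝓡 m₂)) (boundaryInclusion m₂ μ)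
      (productMetric m₁ m₂ g₁ g₂) := by
  obtain ⟨b, hb, hb0, hb', h⟩ := exists_subProductMetric_eq m₁ m₂ M₁ M₂ g₁ g₂ μ
  have ha' (z : SubProduct m₂ M₁ M₂ μ) : 0 < (1 - μ * radius m₂ μ z ^ 2 / 2) ^ 2 :=
    sq_pos_of_ne_zero (ne_zero_of_mem_radialSet z.2.2.2).1
  replace hb' (z : SubProduct m₂ M₁ M₂ μ) : 0 < b (radius m₂ μ z) ^ 2 :=
    sq_pos_of_ne_zero (hb' _ z.2.2.2)
  have hr {z : SubProduct m₂ M₁ M₂ μ}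
      (hz : z ∈ (subProductModel m₁ m₂).interior (SubProduct m₂ M₁ M₂ μ)) : radius m₂ μ z ≠ 0 :=
    ((mem_interior_subProduct_iff z).1 hz).ne'
  have hC {r : ℝ} (h : r ≠ 0) : ContDiffAt ℝ ∞ (fun s : ℝ => (s ^ 2)⁻¹) r := by
    have h : r ^ 2 ≠ 0 := pow_ne_zero 2 h
    fun_prop (disch := assumption)
  have hA : ContDiff ℝ ∞ (fun s : ℝ => (1 - μ * s ^ 2 / 2) ^ 2) := by fun_prop
  have hB : ContDiff ℝ ∞ (fun s : ℝ => b s ^ 2) := hb.pow 2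
  have hC' {z : SubProduct m₂ M₁ M₂ μ}
      (hz : z ∈ (subProductModel m₁ m₂).interior (SubProduct m₂ M₁ M₂ μ)) :
      0 < (radius m₂ μ z ^ 2)⁻¹ := inv_pos.2 (sq_pos_of_ne_zero (hr hz))
  -- The defining function is r itself. The compactified metric drops the factor r⁻² and uses the
  -- zero-free coefficient `b` for `g₂`; since both warping coefficients are 1 at r = 0, the
  -- conformal factor on the boundary is 1.
  refine ⟨isSmoothEmbedding_boundaryInclusion, range_boundaryInclusion,
    warpedField (fun _ => 1) (fun r => (1 - μ * r ^ 2 / 2) ^ 2) (fun r => b r ^ 2) g₁ g₂ μ,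
    radius m₂ μ, ⟨?_, isDefiningFunction_radius, ?_, fun z hz => ?_⟩,
    fun _ => 1, contMDiff_const, fun _ => one_pos, fun x => ?_⟩
  · rw [h]
    exact isMetricOn_warpedField hg₁ hg₂ (fun z hz => hC' hz)
      (fun z hz => mul_pos (hC' hz) (ha' z)) (fun z hz => mul_pos (hC' hz) (hb' z))
      (fun z hz => hC (hr hz)) (fun z hz => (hC (hr hz)).mul hA.contDiffAt)
      (fun z hz => (hC (hr hz)).mul hB.contDiffAt)
  · exact isMetricOn_warpedField hg₁ hg₂ (fun _ _ => one_pos) (fun z _ => ha' z)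
      (fun z _ => hb' z) (fun _ _ => contDiffAt_const) (fun _ _ => hA.contDiffAt)
      (fun _ _ => hB.contDiffAt)
  · rw [h]
    refine ContinuousLinearMap.ext fun v => ContinuousLinearMap.ext fun w => ?_
    refine (warpedField_apply _ _ _ g₁ g₂ z v w).trans (Eq.trans ?_
      (congrArg (radius m₂ μ z ^ 2 * ·) (warpedField_apply _ _ _ g₁ g₂ z v w)).symm)
    have e (d a x b y : ℝ) : 1 * d + a * x + b * y = radius m₂ μ z ^ 2 *
        ((radius m₂ μ z ^ 2)⁻¹ * d + (radius m₂ μ z ^ 2)⁻¹ * a * x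
          + (radius m₂ μ z ^ 2)⁻¹ * b * y) := by
      have := hr hz
      field_simp
    exact e _ _ _ _ _
  · rw [one_smul]
    exact congrFun (pullback_boundaryInclusion g₁ g₂ (by simp) (by simp [hb0])) x

end SubProduct

end PoincareEinstein

end

theorem theorem4p1 (m₁ m₂ : ℕ) (hm₁ : 1 ≤ m₁)
    {M₁ : Type*} [TopologicalSpace M₁] [ChartedSpace (EuclideanSpace ℝ (Fin m₁)) M₁]
    [IsManifold (𝓡 m₁) ∞ M₁]
    {M₂ : Type*} [TopologicalSpace M₂] [ChartedSpace (EuclideanSpace ℝ (Fin m₂)) M₂]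
    [IsManifold (𝓡 m₂) ∞ M₂]
    (g₁ : PoincareEinstein.BilinField (𝓡 m₁) M₁) (g₂ : PoincareEinstein.BilinField (𝓡 m₂) M₂)
    (p₁ q₁ p₂ q₂ : ℕ)
    (hg₁ : PoincareEinstein.IsMetricOn (𝓡 m₁) Set.univ p₁ q₁ g₁)
    (hg₂ : PoincareEinstein.IsMetricOn (𝓡 m₂) Set.univ p₂ q₂ g₂)
    (hE₁ : ∃ c : ℝ, PoincareEinstein.IsEinsteinOn (𝓡 m₁) Set.univ c g₁)
    (hE₂ : ∃ c : ℝ, PoincareEinstein.IsEinsteinOn (𝓡 m₂) Set.univ c g₂)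
    (hSc : ∀ (x : M₁) (y : M₂),
      (m₂ : ℝ) * ((m₂ : ℝ) - 1) * PoincareEinstein.scalarCurvature (𝓡 m₁) g₁ x =
        -((m₁ : ℝ) * ((m₁ : ℝ) - 1) * PoincareEinstein.scalarCurvature (𝓡 m₂) g₂ y)) :
    (∃ μ : ℝ, PoincareEinstein.IsAdmissible m₁ m₂
      (PoincareEinstein.scalarCurvature (𝓡 m₁) g₁)
      (PoincareEinstein.scalarCurvature (𝓡 m₂) g₂) μ) ∧
    ∀ μ : ℝ, PoincareEinstein.IsAdmissible m₁ m₂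
      (PoincareEinstein.scalarCurvature (𝓡 m₁) g₁)
      (PoincareEinstein.scalarCurvature (𝓡 m₂) g₂) μ →
      PoincareEinstein.IsEinsteinOn (PoincareEinstein.subProductModel m₁ m₂)
        ((PoincareEinstein.subProductModel m₁ m₂).interior
          (PoincareEinstein.SubProduct m₂ M₁ M₂ μ))
        (-((m₁ : ℝ) + (m₂ : ℝ)))
        (PoincareEinstein.subProductMetric m₁ m₂ g₁ g₂ μ) ∧
      PoincareEinstein.HasConformalInfinity (PoincareEinstein.subProductModel m₁ m₂)
        (p₁ + p₂ + 1) (q₁ + q₂)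
        (PoincareEinstein.subProductMetric m₁ m₂ g₁ g₂ μ)
        ((𝓡 m₁).prod (𝓡 m₂)) (PoincareEinstein.boundaryInclusion m₂ μ)
        (PoincareEinstein.productMetric m₁ m₂ g₁ g₂) := by
  obtain ⟨κ₁, h₁⟩ := PoincareEinstein.exists_scalarCurvature_eq hg₁ hE₁
  obtain ⟨κ₂, h₂⟩ := PoincareEinstein.exists_scalarCurvature_eq hg₂ hE₂
  exact ⟨PoincareEinstein.exists_isAdmissible hm₁ h₁ h₂ hSc, fun μ hμ =>
    ⟨PoincareEinstein.isEinsteinOn_subProductMetric hg₁ hg₂ hE₁ hE₂ hμ,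
      PoincareEinstein.hasConformalInfinity_subProductMetric hg₁ hg₂ μ⟩⟩
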